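/- Let $X$ be a wedge of $n\ge 3$ circles with oriented petals $a_1,\dots,a_n$, and let $f:Y\to X$ be a finite normal cover ($Y$ connected) with deck group $G$. Let $\Gamma_G$ be the group of homotopy classes of homotopy equivalences $F:X\to X$ that lift to $Y$ and act trivially on $G$, i.e. that have a lift $\widetilde F:Y\to Y$ (so $f\circ\widetilde F=F\circ f$) with $\widetilde F\circ g=g\circ\widetilde F$ for all $g\in G$. It acts on $H_1(Y;\mathbb Q)$ through these lifts $\widetilde F$ (each $F$ determines $\widetilde F$ up to composition with a central element of $G$), and the $\Gamma_G$-orbit of $v$ is the set of all $\widetilde F_*(v)$. Then for every nonzero $v\in H_1(Y;\mathbb Q)$ the $\Gamma_G$-orbit of $v$ is infinite. More precisely, for every nonzero $v\in H_1(Y;\mathbb Q)$ there are an index $i$, a loop $\ell$ in $X$ based at the wedge point that meets $a_i$ at most in the wedge point, and a homotopy equivalence $F:X\to X$ with a lift $\widetilde F:Y\to Y$ commuting with $G$, such that $F$ is the edge-slide of $a_i$ along $\ell$ (that is, $F$ is the identity on every petal $a_j$ with $j\ne i$, and $F$ maps $a_i$ to the concatenation $\ell * a_i$), the induced map $\widetilde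 F_*$ on $H_1(Y;\mathbb Q)$ is an automorphism, and the iterates $\widetilde F_*^{\,d}(v)$, $d\in\mathbb Z$, are pairwise distinct. -/

import Mathlib

open CategoryTheory ContinuousMap
open scoped unitInterval

/-- The equivalence relation on `n` disjoint circles that identifies the `n` base points
(the points `0` of the circles `ℝ / ℤ`) with each other and nothing else. -/
def wedgeSetoid (n : ℕ) : Setoid (Fin n × UnitAddCircle) where
  r a b := a = b ∨ (a.2 = 0 ∧ b.2 = 0)
  iseqv :=
    { refl := fun _ => Or.inl rfl
      symm := by
        rintro a b (h | ⟨h, h'⟩)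
        · exact Or.inl h.symm
        · exact Or.inr ⟨h', h⟩
      trans := by
        rintro a b c (rfl | ⟨h, h'⟩) (rfl | ⟨k, k'⟩)
        · exact Or.inl rfl
        · exact Or.inr ⟨k, k'⟩
        · exact Or.inr ⟨h, h'⟩
        · exact Or.inr ⟨h, k'⟩ }

/-- The wedge of `n` circles (for `n ≥ 1`), with the quotient topology. -/
def Wedge (n : ℕ) : Type := Quotient (wedgeSetoid n)

instance (n : ℕ) : TopologicalSpace (Wedge n) :=
  inferInstanceAs (TopologicalSpace (Quotient (wedgeSetoid n)))

namespace Wedge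

variable {n : ℕ}

/-- The point `z` of the `i`-th circle, as a point of the wedge. -/
def mk (i : Fin n) (z : UnitAddCircle) : Wedge n := Quotient.mk (wedgeSetoid n) (i, z)

theorem continuous_mk (i : Fin n) : Continuous (mk i) :=
  continuous_quotient_mk'.comp (Continuous.prodMk_right i)

/-- The wedge point, seen as a point of the `i`-th circle; it does not depend on `i`. -/
def base (i : Fin n) : Wedge n := mk i 0

theorem base_eq_base (i j : Fin n) : base i = base j :=
  Quotient.sound (s := wedgeSetoid n) (Or.inr ⟨rfl, rfl⟩)

/-- The `i`-th oriented petal `a_i`: the loop at the wedge point that runs once around the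
`i`-th circle. -/
def petal (i : Fin n) : Path (base i) (base i) where
  toFun t := mk i ((t : ℝ) : UnitAddCircle)
  continuous_toFun := (continuous_mk i).comp
    ((AddCircle.continuous_mk' (1 : ℝ)).comp continuous_subtype_val)
  source' := by simp [base]
  target' := by
    have h : ((1 : ℝ) : UnitAddCircle) = 0 := AddCircle.coe_period 1
    simp [base, h]

/-- `F` is the edge-slide of the petal `a_i` along the loop `ℓ`: the loop `ℓ` meets the `i`-th
circle at most in the wedge point, `F` is the identity on all other circles, and `F` maps the
petal `a_i` to the concatenation of `ℓ` followed by `a_i`. These conditions determine `F`. -/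
structure IsEdgeSlide (i : Fin n) (ℓ : Path (base i) (base i)) (F : C(Wedge n, Wedge n)) :
    Prop where
  avoids : ∀ t, ∃ j, j ≠ i ∧ ∃ z, ℓ t = mk j z
  fixes : ∀ j, j ≠ i → ∀ z, F (mk j z) = mk j z
  slides : ∀ t : I, F (petal i t) = (ℓ.trans (petal i)) t

end Wedge

section Cover

variable {X Y : Type} [TopologicalSpace X] [TopologicalSpace Y]

/-- The deck group of a map `f : Y → X`: all self-homeomorphisms `g` of `Y` with `f ∘ g = f`. -/
def deckGroup (f : Y → X) : Subgroup (Y ≃ₜ Y) where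
  carrier := {g | ∀ y, f (g y) = f y}
  one_mem' := fun _ => rfl
  mul_mem' := fun {a b} ha hb y => (ha (b y)).trans (hb y)
  inv_mem' := fun {a} ha y => by
    have h := ha (a⁻¹ y)
    rw [← h]
    exact congrArg f (a.apply_symm_apply y)

/-- `f : Y → X` is a finite normal (regular) cover: a connected covering space with finite fibres,
whose deck group acts transitively on each fibre. -/
structure IsFiniteNormalCover (f : Y → X) : Prop where
  connected : ConnectedSpace Y
  isCoveringMap : IsCoveringMap f
  surjective : Function.Surjective f
  finite_fiber : ∀ x, (f ⁻¹' {x}).Finite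
  transitive : ∀ y y', f y = f y' → ∃ g ∈ deckGroup f, g y = y'

/-- `Ft : Y → Y` is a lift of `F : X → X` along `f` that acts trivially on the deck group `G`,
i.e. for which `Ft ∘ g = g ∘ Ft` for all `g` in `G`. -/
structure IsLiftTrivialOnDeck (f : Y → X) (F : C(X, X)) (Ft : C(Y, Y)) : Prop where
  lifts : ∀ y, f (Ft y) = F (f y)
  commutes : ∀ g ∈ deckGroup f, ∀ y, Ft (g y) = g (Ft y)

end Cover

section Homology

/-- The first singular homology `H_1(Y; ℚ)`. -/
noncomputable abbrev H1 (Y : Type) [TopologicalSpace Y] : ModuleCat.{0} ℚ :=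
  ((AlgebraicTopology.singularHomologyFunctor (ModuleCat.{0} ℚ) 1).obj (ModuleCat.of ℚ ℚ)).obj
    (TopCat.of Y)

/-- The linear map that a continuous map `φ : Y → Y` induces on `H_1(Y; ℚ)`. -/
noncomputable def H1map {Y : Type} [TopologicalSpace Y] (φ : C(Y, Y)) : H1 Y →ₗ[ℚ] H1 Y :=
  (((AlgebraicTopology.singularHomologyFunctor (ModuleCat.{0} ℚ) 1).obj (ModuleCat.of ℚ ℚ)).map
    (TopCat.ofHom φ)).hom

/-- The orbit of `v ∈ H_1(Y; ℚ)` under the group `Γ_G` of homotopy equivalences of `X` that lift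
to `Y` and act trivially on the deck group `G`. Such an equivalence acts on `H_1(Y; ℚ)` through
its lifts that commute with `G` (two such lifts differ by a central element of `G`), and the orbit
collects the images of `v` under all of them. -/
def gammaOrbit {X Y : Type} [TopologicalSpace X] [TopologicalSpace Y] (f : Y → X) (v : H1 Y) :
    Set (H1 Y) :=
  {w | ∃ (F : X ≃ₕ X) (Ft : C(Y, Y)), IsLiftTrivialOnDeck f F.toFun Ft ∧ w = H1map Ft v}

end Homology

/-! The cover `Y` is a graph: its vertices form one orbit of `G`, and every vertex carries one
outgoing lift of each petal. Hence a class in `H_1(Y; ℚ)` is determined by its edge coefficients,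
and a nonzero `x` has a nonzero coefficient on some lift of a petal `a_i`. Slide `a_i` along a word
`w` in the other petals whose lifts are all closed. The slide lifts to a map fixing all vertices,
and its effect on `x` is to add the sum over `v` of (coefficient of `x` on the `i`-edge at `v`)
times (lift of `w` at `v`). The added class has no `i`-edges, so the induced map `T` satisfies `(T -
1)² = 0`, whence `T^d x = x + d (T x - x)`. It remains to choose `w` with `T x ≠ x`.

Let `c ≠ 0` in `ℚ[G]` collect the `i`-edge coefficients of `x`. The edge coefficients of `T x - x`
are the products of `c` with the Fox derivatives of `w` (`sum_coeff_wordLift`). Let `J` be the right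
ideal of all elements killed by the Fox derivatives of every relation. If `q` generates `G`, then
`(x_j) ↦ ∑ x_j (q_j - 1)` is injective from `J^S` to `J`: a tuple in the kernel satisfies `J x_k =
0` for every `k` (`convolution_eq_zero`), and positivity of `y y*` over `ℚ` then forces `x_k = 0`.
With at least two petals left, comparing dimensions gives `J = 0`. In general one restricts `c` to a
coset of the subgroup generated by `q`.

The passage between singular homology and edges uses cocycles on paths: these are the linear
functionals on one-chains modulo boundaries, in which `H_1` embeds, and a cocycle on `Y` is
determined by its values on initial segments of edges (`cocycle_eq_zero`). -/

section Segments

/-! ### Affine paths and triangles in the interval, the square and the simplex. -/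

/-- The affine path from `a` to `b` in the unit interval. -/
def affineI (a b : I) : C(I, I) := ⟨Set.Icc.convexComb a b, Set.Icc.continuous_convexComb a b⟩

@[simp] theorem affineI_zero (a b : I) : affineI a b 0 = a := Set.Icc.convexComb_zero a b
@[simp] theorem affineI_one (a b : I) : affineI a b 1 = b := Set.Icc.convexComb_one a b
@[simp] theorem affineI_self (a t : I) : affineI a a t = a := Set.Icc.convexComb_eq a t
theorem affineI_zero_one : affineI 0 1 = ContinuousMap.id I :=
  ContinuousMap.ext Set.Icc.convexComb_zero_one

/-- The affine path from `p` to `q` in the unit square. -/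
def segment2 (p q : I × I) : C(I, I × I) := (affineI p.1 q.1).prodMk (affineI p.2 q.2)

theorem segment2_apply (p q : I × I) (t : I) :
    segment2 p q t = (affineI p.1 q.1 t, affineI p.2 q.2 t) := rfl

@[simp] theorem segment2_zero (p q : I × I) : segment2 p q 0 = p := by simp [segment2_apply]
@[simp] theorem segment2_one (p q : I × I) : segment2 p q 1 = q := by simp [segment2_apply]

/-- A function on the paths of `Y` is a cocycle if it is additive over the boundary of every
affine triangle in a singular square. -/
def IsPathCocycle {Y V : Type} [TopologicalSpace Y] [AddCommGroup V] (κ : C(I, Y) → V) : Prop :=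
  ∀ (H : C(I × I, Y)) (p q r : I × I),
    κ (H.comp (segment2 p q)) + κ (H.comp (segment2 q r)) = κ (H.comp (segment2 p r))

/-- The affine map from the standard triangle to the unit interval with given values at the
vertices. -/
def affineTriangle (a b c : I) : C(stdSimplex ℝ (Fin 3), I) where
  toFun x := ⟨x 0 * a + x 1 * b + x 2 * c, by
    have h0 := stdSimplex.zero_le x 0
    have h1 := stdSimplex.zero_le x 1
    have h2 := stdSimplex.zero_le x 2
    have hs := stdSimplex.sum_eq_one x
    rw [Fin.sum_univ_three] at hs
    have := a.2.1; have := b.2.1; have := c.2.1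
    have := mul_le_of_le_one_right h0 a.2.2
    have := mul_le_of_le_one_right h1 b.2.2
    have := mul_le_of_le_one_right h2 c.2.2
    exact ⟨by positivity, by linarith⟩⟩
  continuous_toFun := by
    have h (i : Fin 3) : Continuous fun x : stdSimplex ℝ (Fin 3) => x i :=
      (continuous_apply i).comp continuous_subtype_val
    have h0 := h 0
    have h1 := h 1
    have h2 := h 2
    exact Continuous.subtype_mk (((h0.mul continuous_const).add (h1.mul continuous_const)).add
      (h2.mul continuous_const)) _

/-- The inclusion of the `i`-th face of the standard triangle, as a path. -/
noncomputable def facePath (i : Fin 3) : C(I, stdSimplex ℝ (Fin 3)) :=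
  (ContinuousMap.mk (stdSimplex.map (Fin.succAbove i)) (stdSimplex.continuous_map _)).comp
    ⟨stdSimplexHomeomorphUnitInterval.symm, stdSimplexHomeomorphUnitInterval.symm.continuous⟩

theorem facePath_apply (i : Fin 3) (t : I) (j : Fin 3) :
    facePath i t j =
      (if i.succAbove 0 = j then 1 - (t : ℝ) else 0) + if i.succAbove 1 = j then (t : ℝ) else 0 := by
  have h : facePath i t j = FunOnFinite.linearMap ℝ ℝ (Fin.succAbove i)
    (stdSimplexHomeomorphUnitInterval.symm t) j := rfl
  rw [h, FunOnFinite.linearMap_apply_apply, Finset.sum_filter, Fin.sum_univ_two]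
  rfl

theorem facePath_zero (t : I) :
    facePath 0 t 0 = 0 ∧ facePath 0 t 1 = 1 - (t : ℝ) ∧ facePath 0 t 2 = t := by
  simp [facePath_apply, Fin.ext_iff]

theorem facePath_one (t : I) :
    facePath 1 t 0 = 1 - (t : ℝ) ∧ facePath 1 t 1 = 0 ∧ facePath 1 t 2 = t := by
  simp [facePath_apply, Fin.succAbove]

theorem facePath_two (t : I) :
    facePath 2 t 0 = 1 - (t : ℝ) ∧ facePath 2 t 1 = t ∧ facePath 2 t 2 = 0 := by
  simp [facePath_apply, Fin.succAbove, Fin.ext_iff]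

theorem affineTriangle_facePath (a b c : I) :
    (affineTriangle a b c).comp (facePath 0) = affineI b c ∧
    (affineTriangle a b c).comp (facePath 1) = affineI a c ∧
    (affineTriangle a b c).comp (facePath 2) = affineI a b := by
  refine ⟨?_, ?_, ?_⟩ <;> ext t
  · obtain ⟨h0, h1, h2⟩ := facePath_zero t
    simp [affineTriangle, affineI, h0, h1, h2]
  · obtain ⟨h0, h1, h2⟩ := facePath_one t
    simp [affineTriangle, affineI, h0, h1, h2]
  · obtain ⟨h0, h1, h2⟩ := facePath_two t
    simp [affineTriangle, affineI, h0, h1, h2]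

/-- The folding map from the square to the standard triangle that is affine above and below the
diagonal. -/
noncomputable def squareToTriangle : C(I × I, stdSimplex ℝ (Fin 3)) where
  toFun p := ⟨![1 - (p.1 : ℝ), p.1 - min (p.1 : ℝ) p.2, min (p.1 : ℝ) p.2], by
    refine ⟨?_, ?_⟩
    · intro i
      fin_cases i
      · simpa using p.1.2.2
      · simp
      · simpa using ⟨p.1.2.1, p.2.2.1⟩
    · simp [Fin.sum_univ_three]⟩
  continuous_toFun := by
    refine Continuous.subtype_mk (continuous_pi fun i => ?_) _
    fin_cases i <;> simp <;> fun_prop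

theorem squareToTriangle_apply (p : I × I) (i : Fin 3) :
    squareToTriangle p i = ![1 - (p.1 : ℝ), p.1 - min (p.1 : ℝ) p.2, min (p.1 : ℝ) p.2] i := rfl

/-- This turns a singular triangle into a singular square, so that a condition stated on squares
also controls boundaries of singular simplices. -/
theorem squareToTriangle_segment2 :
    squareToTriangle.comp (segment2 (1, 0) (1, 1)) = facePath 0 ∧
    squareToTriangle.comp (segment2 (0, 0) (1, 1)) = facePath 1 ∧
    squareToTriangle.comp (segment2 (0, 0) (1, 0)) = facePath 2 := by
  refine ⟨?_, ?_, ?_⟩ <;> refine ContinuousMap.ext fun t => stdSimplex.ext (funext fun i => ?_) <;>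
    have h0 := t.2.1 <;> have h1 := t.2.2 
  · obtain ⟨e0, e1, e2⟩ := facePath_zero t
    rw [ContinuousMap.comp_apply, squareToTriangle_apply]
    fin_cases i
    · exact Eq.trans (by simp [segment2_apply, affineI]) e0.symm
    · exact Eq.trans (by simp [segment2_apply, affineI, h1]) e1.symm
    · exact Eq.trans (by simp [segment2_apply, affineI, h1]) e2.symm
  · obtain ⟨e0, e1, e2⟩ := facePath_one t
    rw [ContinuousMap.comp_apply, squareToTriangle_apply]
    fin_cases i
    · exact Eq.trans (by simp [segment2_apply, affineI]) e0.symm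
    · exact Eq.trans (by simp [segment2_apply, affineI]) e1.symm
    · exact Eq.trans (by simp [segment2_apply, affineI]) e2.symm
  · obtain ⟨e0, e1, e2⟩ := facePath_two t
    rw [ContinuousMap.comp_apply, squareToTriangle_apply]
    fin_cases i
    · exact Eq.trans (by simp [segment2_apply, affineI]) e0.symm
    · exact Eq.trans (by simp [segment2_apply, affineI, h0]) e1.symm
    · exact Eq.trans (by simp [segment2_apply, affineI, h0]) e2.symm

end Segments

/-! ### Singular one-chains modulo boundaries and their linear functionals. -/

section Chains

open AlgebraicTopology Opposite
open scoped Simplicial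

/-- The singular simplicial set. -/
noncomputable abbrev singularSet (Y : Type) [TopologicalSpace Y] : SSet.{0} :=
  TopCat.toSSet.obj (TopCat.of Y)

/-- The singular chain complex with rational coefficients. -/
noncomputable abbrev rationalChains (Y : Type) [TopologicalSpace Y] :
    ChainComplex (ModuleCat.{0} ℚ) ℕ :=
  (singularSet Y).chainComplex (ModuleCat.of ℚ ℚ)

variable {Y : Type} [TopologicalSpace Y]

/-- Simplices of the singular simplicial set are continuous maps from the standard simplex. -/
noncomputable def simplexEquiv (Y : Type) [TopologicalSpace Y] (n : ℕ) :
    (singularSet Y) _⦋n⦌ ≃ C(stdSimplex ℝ (Fin (n + 1)), Y) :=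
  TopCat.toSSetObjEquiv (TopCat.of Y) (op ⦋n⦌)

/-- Singular `1`-simplices are paths. -/
noncomputable def pathSimplexEquiv (Y : Type) [TopologicalSpace Y] :
    (singularSet Y) _⦋1⦌ ≃ C(I, Y) :=
  (simplexEquiv Y 1).trans (stdSimplexHomeomorphUnitInterval.continuousMapCongr (.refl Y))

theorem pathSimplexEquiv_δ (x : (singularSet Y) _⦋2⦌) (i : Fin 3) :
    pathSimplexEquiv Y ((singularSet Y).δ i x) = (simplexEquiv Y 2 x).comp (facePath i) := rfl

/-- One-chains modulo boundaries. -/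
noncomputable abbrev ChainsModBoundaries (Y : Type) [TopologicalSpace Y] : ModuleCat.{0} ℚ :=
  (rationalChains Y).opcycles 1

/-- The class of a path in the one-chains modulo boundaries. -/
noncomputable def pathClass (γ : C(I, Y)) : ChainsModBoundaries Y :=
  ((singularSet Y).ιChainComplex ((pathSimplexEquiv Y).symm γ) ≫
    (rationalChains Y).pOpcycles 1).hom (1 : ℚ)

theorem ModuleCat.hom_ext_one {V : ModuleCat.{0} ℚ} {f g : ModuleCat.of ℚ ℚ ⟶ V}
    (h : f.hom (1 : ℚ) = g.hom (1 : ℚ)) : f = g :=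
  ModuleCat.hom_ext (LinearMap.ext_ring h)

theorem ChainsModBoundaries.hom_ext {V : ModuleCat.{0} ℚ} {f g : ChainsModBoundaries Y ⟶ V}
    (h : ∀ γ, f.hom (pathClass γ) = g.hom (pathClass γ)) : f = g := by
  rw [← cancel_epi ((rationalChains Y).pOpcycles 1)]
  refine SSet.chainComplex_hom_ext fun x => ModuleCat.hom_ext_one ?_
  have := h (pathSimplexEquiv Y x)
  simpa [pathClass] using this

/-- Linear maps on one-chains modulo boundaries are determined by their values on paths. -/
theorem ChainsModBoundaries.linearMap_ext {V : Type} [AddCommGroup V] [Module ℚ V]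
    {f g : ChainsModBoundaries Y →ₗ[ℚ] V} (h : ∀ γ, f (pathClass γ) = g (pathClass γ)) :
    f = g :=
  congrArg ModuleCat.Hom.hom (ChainsModBoundaries.hom_ext (V := ModuleCat.of ℚ V)
    (f := ModuleCat.ofHom f) (g := ModuleCat.ofHom g) h)

theorem pathClass_face (τ : C(stdSimplex ℝ (Fin 3), Y)) :
    pathClass (τ.comp (facePath 2)) + pathClass (τ.comp (facePath 0)) =
      pathClass (τ.comp (facePath 1)) := by
  have h := SSet.ιChainComplex_d (R := ModuleCat.of ℚ ℚ) (X := singularSet Y)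
    ((simplexEquiv Y 2).symm τ)
  have h2 := congrArg (fun f => (f ≫ (rationalChains Y).pOpcycles 1).hom (1 : ℚ)) h
  simp only [Category.assoc, HomologicalComplex.d_pOpcycles, Limits.comp_zero] at h2
  rw [Fin.sum_univ_three] at h2
  have h3 (i : Fin 3) : pathClass (τ.comp (facePath i)) =
      ((singularSet Y).ιChainComplex ((singularSet Y).δ i ((simplexEquiv Y 2).symm τ)) ≫
      (rationalChains Y).pOpcycles 1).hom (1 : ℚ) := by
    have := pathSimplexEquiv_δ ((simplexEquiv Y 2).symm τ) i
    rw [Equiv.apply_symm_apply] at this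
    rw [pathClass, ← this, Equiv.symm_apply_apply]
  rw [h3, h3, h3]
  simp [Preadditive.add_comp] at h2 ⊢
  rw [← sub_eq_zero, h2]
  abel

/-- Taking the class of a path is a cocycle. -/
theorem isPathCocycle_pathClass : IsPathCocycle (pathClass : C(I, Y) → ChainsModBoundaries Y) := by
  intro H p q r
  have h := pathClass_face (H.comp ((affineTriangle p.1 q.1 r.1).prodMk
    (affineTriangle p.2 q.2 r.2)))
  obtain ⟨a0, a1, a2⟩ := affineTriangle_facePath p.1 q.1 r.1
  obtain ⟨b0, b1, b2⟩ := affineTriangle_facePath p.2 q.2 r.2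
  have e (i) : ((affineTriangle p.1 q.1 r.1).prodMk (affineTriangle p.2 q.2 r.2)).comp (facePath i)
    = ((affineTriangle p.1 q.1 r.1).comp (facePath i)).prodMk
      ((affineTriangle p.2 q.2 r.2).comp (facePath i)) := rfl
  simp only [ContinuousMap.comp_assoc, e, a0, a1, a2, b0, b1, b2] at h
  exact h

variable {V : Type} [AddCommGroup V] [Module ℚ V]

omit [Module ℚ V] in
theorem IsPathCocycle.face {κ : C(I, Y) → V} (hκ : IsPathCocycle κ)
    (τ : C(stdSimplex ℝ (Fin 3), Y)) :
    κ (τ.comp (facePath 2)) + κ (τ.comp (facePath 0)) = κ (τ.comp (facePath 1)) := by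
  obtain ⟨h0, h1, h2⟩ := squareToTriangle_segment2
  rw [← h0, ← h1, ← h2]
  exact hκ (τ.comp squareToTriangle) (0, 0) (1, 0) (1, 1)

theorem exists_chain_map (n : ℕ) (κ : (singularSet Y) _⦋n⦌ → V) :
    ∃ f : (rationalChains Y).X n ⟶ ModuleCat.of ℚ V, ∀ x,
      ((singularSet Y).ιChainComplex x ≫ f).hom (1 : ℚ) = κ x := by
  refine ⟨((singularSet Y).isColimitChainComplexXCofan (ModuleCat.of ℚ ℚ) n).desc
    (Limits.Cofan.mk (ModuleCat.of ℚ V)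
      fun x => ModuleCat.ofHom (LinearMap.toSpanSingleton ℚ V (κ x))), fun x => ?_⟩
  have := ((singularSet Y).isColimitChainComplexXCofan (ModuleCat.of ℚ ℚ) n).fac
    (Limits.Cofan.mk (ModuleCat.of ℚ V)
      fun x => ModuleCat.ofHom (LinearMap.toSpanSingleton ℚ V (κ x))) ⟨x⟩
  have h2 := congrArg (fun f => f.hom (1 : ℚ)) this
  refine Eq.trans h2 ?_
  simp

/-- A cocycle extends to a linear map on one-chains modulo boundaries. -/
theorem IsPathCocycle.exists_linearMap {κ : C(I, Y) → V} (hκ : IsPathCocycle κ) :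
    ∃ f : ChainsModBoundaries Y →ₗ[ℚ] V, ∀ γ, f (pathClass γ) = κ γ := by
  obtain ⟨f, hf⟩ := exists_chain_map 1 (fun x => κ (pathSimplexEquiv Y x))
  have hd : (rationalChains Y).d 2 1 ≫ f = 0 := by
    refine SSet.chainComplex_hom_ext fun x => ModuleCat.hom_ext_one ?_
    rw [← Category.assoc, SSet.ιChainComplex_d, Fin.sum_univ_three]
    simp only [Preadditive.add_comp, Limits.comp_zero]
    have h := hκ.face (simplexEquiv Y 2 x)
    simp only [← pathSimplexEquiv_δ] at h
    rw [← hf, ← hf, ← hf] at h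
    simp at h ⊢
    rw [← h]
    abel
  refine ⟨((rationalChains Y).descOpcycles f 2 (by simp) hd).hom, fun γ => ?_⟩
  have := hf ((pathSimplexEquiv Y).symm γ)
  rw [Equiv.apply_symm_apply] at this
  rw [← this, pathClass, ← LinearMap.comp_apply, ← ModuleCat.hom_comp, Category.assoc,
    HomologicalComplex.p_descOpcycles]

/-- The linear map on one-chains modulo boundaries given by a cocycle. -/
noncomputable def IsPathCocycle.linearMap {κ : C(I, Y) → V} (hκ : IsPathCocycle κ) :
    ChainsModBoundaries Y →ₗ[ℚ] V := hκ.exists_linearMap.choose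

@[simp] theorem IsPathCocycle.linearMap_pathClass {κ : C(I, Y) → V} (hκ : IsPathCocycle κ)
    (γ : C(I, Y)) : hκ.linearMap (pathClass γ) = κ γ := hκ.exists_linearMap.choose_spec γ

/-- The inclusion of the first homology in the one-chains modulo boundaries. -/
noncomputable def homologyIncl (Y : Type) [TopologicalSpace Y] :
    H1 Y →ₗ[ℚ] ChainsModBoundaries Y := ((rationalChains Y).homologyι 1).hom

theorem homologyIncl_injective : Function.Injective (homologyIncl Y) :=
  (ModuleCat.mono_iff_injective ((rationalChains Y).homologyι 1)).mp inferInstance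

omit [Module ℚ V] in
theorem isPathCocycle_boundary (u : Y → V) : IsPathCocycle fun γ : C(I, Y) => u (γ 1) - u (γ 0) := by
  intro H p q r
  simp

/-- Functions of the end points vanish on cycles. -/
theorem boundary_linearMap_homologyIncl (u : Y → V) (x : H1 Y) :
    (isPathCocycle_boundary u).linearMap (homologyIncl Y x) = 0 := by
  obtain ⟨f, hf⟩ := exists_chain_map (Y := Y) 0
    (fun x => u (simplexEquiv Y 0 x default))
  -- The functional factors through the differential to zero-chains, which kills homology classes.
  have h : (isPathCocycle_boundary u).linearMap =
      ((rationalChains Y).fromOpcycles 1 0 ≫ f).hom := by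
    refine ChainsModBoundaries.linearMap_ext fun γ => ?_
    rw [IsPathCocycle.linearMap_pathClass, pathClass, ← LinearMap.comp_apply, ← ModuleCat.hom_comp,
      Category.assoc, HomologicalComplex.p_fromOpcycles_assoc, ← Category.assoc,
      SSet.ιChainComplex_d, Fin.sum_univ_two]
    simp only [Preadditive.add_comp]
    have h0 := hf ((singularSet Y).δ 0 ((pathSimplexEquiv Y).symm γ))
    have h1 := hf ((singularSet Y).δ 1 ((pathSimplexEquiv Y).symm γ))
    simp at h0 h1 ⊢
    rw [h0, h1, ← sub_eq_add_neg]
    have e (i : Fin 2) : simplexEquiv Y 0 ((singularSet Y).δ i ((pathSimplexEquiv Y).symm γ)) default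
      = γ (stdSimplexHomeomorphUnitInterval (stdSimplex.map (Fin.succAbove i) default)) := rfl
    rw [e, e]
    congr 3
    · ext
      change (1 : ℝ) = stdSimplex.map (Fin.succAbove (0 : Fin 2)) default 1
      rw [stdSimplex.map_coe, FunOnFinite.linearMap_apply_apply, Finset.sum_filter]
      simp [Finset.filter_singleton]
    · ext
      change (0 : ℝ) = stdSimplex.map (Fin.succAbove (1 : Fin 2)) default 1
      rw [stdSimplex.map_coe, FunOnFinite.linearMap_apply_apply, Finset.sum_filter]
      simp
  have h2 : (rationalChains Y).homologyι 1 ≫ (rationalChains Y).fromOpcycles 1 0 ≫ f = 0 := by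
    rw [HomologicalComplex.homologyι_comp_fromOpcycles_assoc, Limits.zero_comp]
  rw [h]
  exact congrArg (fun f => f.hom x) h2

/-- The map on one-chains modulo boundaries induced by a continuous map. -/
noncomputable def chainsModBoundariesMap (φ : C(Y, Y)) :
    ChainsModBoundaries Y →ₗ[ℚ] ChainsModBoundaries Y :=
  (HomologicalComplex.opcyclesMap (SSet.chainComplexMap
    (TopCat.toSSet.map (TopCat.ofHom φ)) (ModuleCat.of ℚ ℚ)) 1).hom

theorem chainsModBoundariesMap_pathClass (φ : C(Y, Y)) (γ : C(I, Y)) :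
    chainsModBoundariesMap φ (pathClass γ) = pathClass (φ.comp γ) := by
  rw [chainsModBoundariesMap, pathClass, ← LinearMap.comp_apply, ← ModuleCat.hom_comp,
    Category.assoc, HomologicalComplex.p_opcyclesMap, SSet.ι_chainComplexMap_f_assoc]
  rfl

theorem homologyIncl_H1map (φ : C(Y, Y)) (x : H1 Y) :
    homologyIncl Y (H1map φ x) = chainsModBoundariesMap φ (homologyIncl Y x) := by
  have := HomologicalComplex.homologyι_naturality (SSet.chainComplexMap
    (TopCat.toSSet.map (TopCat.ofHom φ)) (ModuleCat.of ℚ ℚ)) 1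
  exact congrArg (fun f => f.hom x) this

theorem H1map_id (x : H1 Y) : H1map (ContinuousMap.id Y) x = x := by
  apply homologyIncl_injective
  rw [homologyIncl_H1map]
  have : chainsModBoundariesMap (ContinuousMap.id Y) = LinearMap.id :=
    ChainsModBoundaries.linearMap_ext fun γ => by
      rw [chainsModBoundariesMap_pathClass]; rfl
  rw [this]
  rfl

theorem H1map_comp (φ ψ : C(Y, Y)) (x : H1 Y) : H1map (φ.comp ψ) x = H1map φ (H1map ψ x) := by
  apply homologyIncl_injective
  rw [homologyIncl_H1map, homologyIncl_H1map, homologyIncl_H1map]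
  have : chainsModBoundariesMap (φ.comp ψ) =
      chainsModBoundariesMap φ ∘ₗ chainsModBoundariesMap ψ :=
    ChainsModBoundaries.linearMap_ext fun γ => by
      rw [LinearMap.comp_apply]
      iterate 3 rw [chainsModBoundariesMap_pathClass]
      rfl
  rw [this]
  rfl

end Chains

/-! ### Fox derivatives and the rational group ring of a finite group. -/

section FoxCalculus

variable {S G : Type} [Group G]

/-- Right translation of rational functions on a group. -/
def rightTranslate (h : G) : (G → ℚ) →ₗ[ℚ] (G → ℚ) := LinearMap.funLeft ℚ ℚ fun x => x * h⁻¹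

@[simp] theorem rightTranslate_apply (h : G) (c : G → ℚ) (x : G) :
    rightTranslate h c x = c (x * h⁻¹) := rfl

/-- The value of a word in the generators `q j`. -/
def wordProd (q : S → G) (w : List S) : G := (w.map q).prod

@[simp] theorem wordProd_nil (q : S → G) : wordProd q [] = 1 := rfl
@[simp] theorem wordProd_cons (q : S → G) (j : S) (w : List S) :
    wordProd q (j :: w) = q j * wordProd q w := by simp [wordProd]
@[simp] theorem wordProd_append (q : S → G) (u w : List S) :
    wordProd q (u ++ w) = wordProd q u * wordProd q w := by simp [wordProd]

variable [DecidableEq S]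

/-- The product `c * D w` in the rational group ring, where `D w` is the vector of Fox derivatives
of the word `w`. -/
def foxProduct (q : S → G) : List S → (G → ℚ) →ₗ[ℚ] (S → G → ℚ)
  | [] => 0
  | j :: w => LinearMap.single ℚ (fun _ => G → ℚ) j + foxProduct q w ∘ₗ rightTranslate (q j)

@[simp] theorem foxProduct_nil (q : S → G) (c : G → ℚ) : foxProduct q [] c = 0 := rfl
theorem foxProduct_cons (q : S → G) (j : S) (w : List S) (c : G → ℚ) :
    foxProduct q (j :: w) c = Pi.single j c + foxProduct q w (rightTranslate (q j) c) := rfl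

theorem rightTranslate_mul (a b : G) (c : G → ℚ) :
    rightTranslate (a * b) c = rightTranslate b (rightTranslate a c) := by
  ext x
  simp [mul_assoc]

@[simp] theorem rightTranslate_one (c : G → ℚ) : rightTranslate (1 : G) c = c := by
  ext x
  simp

theorem foxProduct_append (q : S → G) (u w : List S) (c : G → ℚ) :
    foxProduct q (u ++ w) c =
      foxProduct q u c + foxProduct q w (rightTranslate (wordProd q u) c) := by
  induction u generalizing c with
  | nil => simp
  | cons j u ih => simp [foxProduct_cons, ih, rightTranslate_mul, add_assoc]

/-- The functions annihilated by the Fox derivatives of all relations. -/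
def relationAnnihilator (q : S → G) : Submodule ℚ (G → ℚ) :=
  ⨅ w : {w : List S // wordProd q w = 1}, LinearMap.ker (foxProduct q w.1)

theorem mem_relationAnnihilator {q : S → G} {c : G → ℚ} :
    c ∈ relationAnnihilator q ↔ ∀ w, wordProd q w = 1 → foxProduct q w c = 0 := by
  simp [relationAnnihilator]

section Generated

variable {q : S → G} (hq : ∀ h, ∃ w, wordProd q w = h)
include hq

/-- If `u` spells `h` and `u'` spells its inverse, then `u w u'` and `u u'` are both relations; the
difference of their Fox products is that of `w` at the translate of `c`. -/
theorem rightTranslate_mem {c : G → ℚ} (hc : c ∈ relationAnnihilator q) (h : G) :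
    rightTranslate h c ∈ relationAnnihilator q := by
  rw [mem_relationAnnihilator] at hc ⊢
  intro w hw
  obtain ⟨u, rfl⟩ := hq h
  obtain ⟨u', hu'⟩ := hq (wordProd q u)⁻¹
  have h1 := hc (u ++ (w ++ u')) (by simp [hw, hu'])
  have h2 := hc (u ++ u') (by simp [hu'])
  rw [foxProduct_append] at h1 h2
  rw [foxProduct_append, hw, rightTranslate_one] at h1
  have := h1.trans h2.symm
  simpa using this

theorem foxProduct_eq_of_wordProd_eq {c : G → ℚ} (hc : c ∈ relationAnnihilator q) {w w' : List S}
    (h : wordProd q w = wordProd q w') : foxProduct q w c = foxProduct q w' c := by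
  rw [mem_relationAnnihilator] at hc
  obtain ⟨u, hu⟩ := hq (wordProd q w)⁻¹
  have h1 := hc (w ++ u) (by simp [hu])
  have h2 := hc (w' ++ u) (by simp [hu, h])
  rw [foxProduct_append] at h1 h2
  rw [← h] at h2
  simpa using h1.trans h2.symm

variable [Fintype G]

/-- A cycle annihilated by all of the annihilator of the relations: convolution vanishes. -/
theorem convolution_eq_zero [Fintype S] {x : S → G → ℚ}
    (hx : ∑ j, (rightTranslate (q j) (x j) - x j) = 0)
    {c : G → ℚ} (hc : c ∈ relationAnnihilator q) (k : S) :
    ∑ h, x k h • rightTranslate h c = 0 := by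
  choose W hW using hq
  -- As `c` is in the annihilator, `foxProduct q (W h) c` depends on `h` alone: it is a potential on
  -- the Cayley graph, whose increment along the edge from `h` to `h * q j` is `rightTranslate h c`
  -- in coordinate `j`. Increments of a potential sum to zero against the cycle `x`, by summation by
  -- parts.
  have key (j : S) (h : G) : foxProduct q (W (h * q j)) c k - foxProduct q (W h) c k =
      if j = k then rightTranslate h c else 0 := by
    rw [foxProduct_eq_of_wordProd_eq (fun h => ⟨W h, hW h⟩) hc
      (show wordProd q (W (h * q j)) = wordProd q (W h ++ [j]) by simp [hW]),
      foxProduct_append, hW]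
    simp only [foxProduct_cons, foxProduct_nil, add_zero, Pi.add_apply, add_sub_cancel_left]
    rw [Pi.single_apply]
    simp only [eq_comm]
  have h1 : ∑ j, ∑ h, x j h • (foxProduct q (W (h * q j)) c k - foxProduct q (W h) c k) =
      ∑ h, x k h • rightTranslate h c := by
    simp only [key]
    rw [Finset.sum_eq_single k]
    · simp
    · intro j _ hj
      simp [hj]
    · simp
  rw [← h1]
  have h2 (j : S) : ∑ h, x j h • (foxProduct q (W (h * q j)) c k - foxProduct q (W h) c k) =
      ∑ h, (rightTranslate (q j) (x j) - x j) h • foxProduct q (W h) c k := by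
    simp only [smul_sub, Pi.sub_apply, sub_smul, Finset.sum_sub_distrib]
    congr 1
    rw [← Equiv.sum_comp (Equiv.mulRight (q j))
      fun h => rightTranslate (q j) (x j) h • foxProduct q (W h) c k]
    simp
  simp only [h2]
  rw [Finset.sum_comm]
  refine Finset.sum_eq_zero fun h _ => ?_
  rw [← Finset.sum_smul]
  have := congrFun hx h
  rw [Finset.sum_apply] at this
  rw [this]
  simp

/-- The hypothesis says `c y = 0` in `ℚ[G]` for all `c` in the right ideal. Take `c = z = y y*`,
which is self-adjoint: then `z z* = z y y* = 0`. The value of `a a*` at `1` is a sum of squares, so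
`z = 0` and then `y = 0`. -/
theorem eq_zero_of_convolution_eq_zero {y : G → ℚ} (hy : y ∈ relationAnnihilator q)
    (h : ∀ c ∈ relationAnnihilator q, ∑ h, y h • rightTranslate h c = 0) : y = 0 := by
  set z : G → ℚ := ∑ h, y h • rightTranslate h⁻¹ y with hz
  have hz_apply (g : G) : z g = ∑ h, y h * y (g * h) := by simp [hz]
  have hzJ : z ∈ relationAnnihilator q :=
    Submodule.sum_mem _ fun h _ => Submodule.smul_mem _ _ (rightTranslate_mem hq hy _)
  have hsymm (g : G) : z g⁻¹ = z g := by
    rw [hz_apply, hz_apply, ← Equiv.sum_comp (Equiv.mulLeft g) fun h => y h * y (g⁻¹ * h)]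
    simp [mul_comm]
  have hz0 : ∑ g, z g * z g = 0 := by
    have h1 (g : G) : z g = ∑ h, y h * y (g⁻¹ * h) := by rw [← hsymm, hz_apply]
    have h2 : ∑ g, z g * z g = ∑ h, y h * ∑ g, y (g⁻¹ * h) * z g := by
      simp only [Finset.mul_sum]
      rw [Finset.sum_comm]
      refine Finset.sum_congr rfl fun g _ => ?_
      rw [show z g * z g = (∑ h, y h * y (g⁻¹ * h)) * z g by rw [← h1], Finset.sum_mul]
      simp only [mul_assoc]
    rw [h2]
    refine Finset.sum_eq_zero fun k _ => ?_
    have h3 := congrFun (h z hzJ) k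
    simp only [Finset.sum_apply, Pi.smul_apply, rightTranslate_apply, smul_eq_mul,
      Pi.zero_apply] at h3
    rw [← Equiv.sum_comp ((Equiv.inv G).trans (Equiv.mulRight k))] at h3
    simp at h3
    simp [h3]
  have hz1 : z = 0 := by
    ext g
    have := (Finset.sum_eq_zero_iff_of_nonneg fun g _ => mul_self_nonneg (z g)).mp hz0 g
      (Finset.mem_univ g)
    simpa using this
  have h1 := hz_apply 1
  rw [hz1] at h1
  ext g
  have := (Finset.sum_eq_zero_iff_of_nonneg fun g _ => mul_self_nonneg (y g)).mp
    (by simpa using h1.symm) g (Finset.mem_univ g)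
  simpa using this

/-- An injection of `J^S` into the finite-dimensional space `J` with at least two factors forces `J
= 0`. -/
theorem relationAnnihilator_eq_bot [Fintype S] (hS : 2 ≤ Fintype.card S) :
    relationAnnihilator q = ⊥ := by
  let J := relationAnnihilator q
  let D (j : S) : J →ₗ[ℚ] J := (rightTranslate (q j) - LinearMap.id).restrict fun c hc =>
    J.sub_mem (rightTranslate_mem hq hc _) hc
  let Φ : (S → J) →ₗ[ℚ] J := ∑ j, D j ∘ₗ LinearMap.proj j
  have hΦ : Function.Injective Φ := by
    rw [injective_iff_map_eq_zero]
    intro x hx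
    have h0 : ∑ j, (rightTranslate (q j) (x j : G → ℚ) - (x j : G → ℚ)) = 0 := by
      have := congrArg (Subtype.val) hx
      simpa [Φ, D] using this
    ext1 k
    refine Subtype.ext (eq_zero_of_convolution_eq_zero hq (x k).2 fun c hc => ?_)
    exact convolution_eq_zero (x := fun j => (x j : G → ℚ)) hq h0 hc k
  have hdim := LinearMap.finrank_le_finrank_of_injective hΦ
  rw [Module.finrank_pi_fintype, Finset.sum_const, Finset.card_univ, smul_eq_mul] at hdim
  have h0 : Module.finrank ℚ J = 0 := by
    by_contra hne
    have : 0 < Module.finrank ℚ J := Nat.pos_of_ne_zero hne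
    nlinarith
  exact Submodule.finrank_eq_zero.mp h0

end Generated

/-- If a finite group is given with at least two elements `q j`, then every nonzero function is
moved by the Fox derivative of some relation between the `q j`. -/
theorem exists_relation_foxProduct_ne_zero [Fintype G] [Fintype S] (hS : 2 ≤ Fintype.card S)
    (q : S → G) {c : G → ℚ} (hc : c ≠ 0) : ∃ w, wordProd q w = 1 ∧ foxProduct q w c ≠ 0 := by
  classical
  obtain ⟨t, ht⟩ := Function.ne_iff.mp hc
  -- The `q j` need not generate `G`; the argument runs in `H` with `c` restricted to the left coset
  -- `t H`, where it is nonzero.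
  let H := Subgroup.closure (Set.range q)
  let q' (j : S) : H := ⟨q j, Subgroup.subset_closure ⟨j, rfl⟩⟩
  have hval (w : List S) : ((wordProd q' w : H) : G) = wordProd q w := by
    induction w with
    | nil => rfl
    | cons j w ih => simp [ih, q']
  have hq' (h : H) : ∃ w, wordProd q' w = h := by
    -- Words have no inverse letters; this costs nothing in a finite group.
    have hh : (h : G) ∈ Submonoid.closure (Set.range q) := by
      rw [← Subgroup.closure_toSubmonoid_of_finite]
      exact h.2
    suffices ∃ w, wordProd q w = h by
      obtain ⟨w, hw⟩ := this
      exact ⟨w, Subtype.ext ((hval w).trans hw)⟩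
    generalize (h : G) = g at hh ⊢
    induction hh using Submonoid.closure_induction with
    | mem x hx =>
      obtain ⟨j, rfl⟩ := hx
      exact ⟨[j], by simp⟩
    | one => exact ⟨[], rfl⟩
    | mul x y _ _ hx hy =>
      obtain ⟨u, rfl⟩ := hx
      obtain ⟨w, rfl⟩ := hy
      exact ⟨u ++ w, by simp⟩
  have hres (w : List S) (c : G → ℚ) (k : S) (h : H) :
      foxProduct q' w (fun h => c (t * h)) k h = foxProduct q w c k (t * h) := by
    induction w generalizing c with
    | nil => simp
    | cons j w ih =>
      have e : rightTranslate (q' j) (fun h : H => c (t * h)) =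
          fun h : H => rightTranslate (q j) c (t * h) := by
        ext h
        simp [q', mul_assoc]
      rw [foxProduct_cons, foxProduct_cons, e, Pi.add_apply, Pi.add_apply, Pi.add_apply,
        Pi.add_apply, ih]
      congr 1
      by_cases hjk : k = j
      · subst hjk
        simp
      · simp [Pi.single_eq_of_ne hjk]
  have hne : (fun h : H => c (t * h)) ∉ relationAnnihilator q' := by
    rw [relationAnnihilator_eq_bot hq' hS, Submodule.mem_bot]
    intro h0
    exact ht (by simpa using congrFun h0 1)
  rw [mem_relationAnnihilator] at hne
  push Not at hne
  obtain ⟨w, hw, hne⟩ := hne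
  refine ⟨w, by rw [← hval, hw]; rfl, fun h0 => hne ?_⟩
  ext k h
  rw [hres, h0]
  rfl

end FoxCalculus

/-! ### Coordinates and paths on the circle and the wedge. -/

section Circle

/-- The representative in `[a, a + 1)` of a point of the circle. -/
noncomputable def circleRep (a : ℝ) (z : UnitAddCircle) : ℝ := AddCircle.equivIco 1 a z

@[simp] theorem coe_circleRep (a : ℝ) (z : UnitAddCircle) : (circleRep a z : UnitAddCircle) = z :=
  (AddCircle.equivIco 1 a).symm_apply_apply z

theorem le_circleRep (a : ℝ) (z : UnitAddCircle) : a ≤ circleRep a z :=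
  (AddCircle.equivIco 1 a z).2.1

theorem circleRep_lt (a : ℝ) (z : UnitAddCircle) : circleRep a z < a + 1 :=
  (AddCircle.equivIco 1 a z).2.2

theorem continuousAt_circleRep {a : ℝ} {z : UnitAddCircle} (hz : z ≠ a) :
    ContinuousAt (circleRep a) z :=
  continuousAt_subtype_val.comp (AddCircle.continuousAt_equivIco 1 a hz)

theorem circleRep_coe {a x : ℝ} (h : a ≤ x) (h' : x < a + 1) :
    circleRep a (x : UnitAddCircle) = x := by
  rw [circleRep, AddCircle.equivIco_coe_eq (⟨h, h'⟩ : x ∈ Set.Ico a (a + 1))]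

theorem unitInterval_coe_eq_coe {s t : I}
    (h : ((s : ℝ) : UnitAddCircle) = ((t : ℝ) : UnitAddCircle)) :
    s = t ∨ (s = 0 ∨ s = 1) ∧ (t = 0 ∨ t = 1) := by
  have key (s t : I) (h : ((s : ℝ) : UnitAddCircle) = ((t : ℝ) : UnitAddCircle)) (hs : s ≠ 1) :
      s = t ∨ (s = 0 ∧ t = 1) := by
    have hs1 : (s : ℝ) < 1 := lt_of_le_of_ne s.2.2 fun e => hs (Subtype.ext e)
    by_cases ht : t = 1
    · subst ht
      have h1 : ((1 : ℝ) : UnitAddCircle) = 0 := AddCircle.coe_period 1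
      have h0 : ((s : ℝ) : UnitAddCircle) = ((0 : ℝ) : UnitAddCircle) := by simpa [h1] using h
      have := congrArg (circleRep 0) h0
      rw [circleRep_coe s.2.1 (by simpa using hs1), circleRep_coe le_rfl (by simp)] at this
      exact Or.inr ⟨Subtype.ext this, rfl⟩
    · have ht1 : (t : ℝ) < 1 := lt_of_le_of_ne t.2.2 fun e => ht (Subtype.ext e)
      have := congrArg (circleRep 0) h
      rw [circleRep_coe s.2.1 (by simpa using hs1), circleRep_coe t.2.1 (by simpa using ht1)]
        at this
      exact Or.inl (Subtype.ext this)
  by_cases hs : s = 1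
  · by_cases ht : t = 1
    · exact Or.inl (hs.trans ht.symm)
    · rcases key t s h.symm ht with h | ⟨h, h'⟩
      · exact Or.inl h.symm
      · exact Or.inr ⟨Or.inr h', Or.inl h⟩
  · rcases key s t h hs with h | ⟨h, h'⟩
    · exact Or.inl h
    · exact Or.inr ⟨Or.inl h, Or.inr h'⟩

end Circle

namespace Wedge

variable {n : ℕ}

theorem mk_eq_mk {i j : Fin n} {z w : UnitAddCircle} :
    mk i z = mk j w ↔ (i = j ∧ z = w) ∨ (z = 0 ∧ w = 0) := by
  refine ⟨fun h => ?_, ?_⟩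
  · rcases Quotient.exact (s := wedgeSetoid n) h with h | h
    · exact Or.inl (Prod.mk.inj h)
    · exact Or.inr h
  · rintro (⟨rfl, rfl⟩ | ⟨rfl, rfl⟩)
    · rfl
    · exact base_eq_base i j

theorem exists_mk (x : Wedge n) : ∃ i z, x = mk i z := by
  obtain ⟨⟨i, z⟩, rfl⟩ := Quotient.exists_rep x
  exact ⟨i, z, rfl⟩

theorem petal_apply (i : Fin n) (t : I) : petal i t = mk i ((t : ℝ) : UnitAddCircle) := rfl

/-- The `k`-th coordinate of a point of the wedge, which is `0` on all other circles. -/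
def coord (k : Fin n) : Wedge n → UnitAddCircle :=
  Quotient.lift (fun p : Fin n × UnitAddCircle => if p.1 = k then p.2 else 0) (by
    rintro a b (rfl | ⟨ha, hb⟩)
    · rfl
    · simp [ha, hb])

theorem coord_mk (k i : Fin n) (z : UnitAddCircle) :
    coord k (mk i z) = if i = k then z else 0 := rfl

@[simp] theorem coord_mk_self (k : Fin n) (z : UnitAddCircle) : coord k (mk k z) = z := by
  simp [coord_mk]

theorem continuous_coord (k : Fin n) : Continuous (coord k) := by
  refine continuous_quot_lift _ (continuous_prod_of_discrete_left.mpr fun i => ?_)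
  by_cases h : i = k <;> simp [h] <;> fun_prop

theorem eq_mk_coord {k : Fin n} {x : Wedge n} (h : coord k x ≠ 0) : x = mk k (coord k x) := by
  obtain ⟨i, z, rfl⟩ := exists_mk x
  rw [coord_mk] at h ⊢
  split_ifs at h ⊢ with hi
  · rw [hi]
  · exact absurd rfl h

theorem coord_injective : Function.Injective fun (x : Wedge n) k => coord k x := by
  intro x y h
  have h' (k) : coord k x = coord k y := congrFun h k
  obtain ⟨i, z, rfl⟩ := exists_mk x
  by_cases hz : z = 0
  · subst hz
    obtain ⟨j, w, rfl⟩ := exists_mk y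
    have := h' j
    rw [coord_mk_self, coord_mk] at this
    rw [← this, mk_eq_mk]
    simp
  · have hi := h' i
    rw [coord_mk_self] at hi
    rw [eq_mk_coord (k := i) (x := y) (hi ▸ hz), ← hi]

theorem continuous_coords : Continuous fun (x : Wedge n) k => coord k x :=
  continuous_pi continuous_coord

instance : T2Space (Wedge n) := T2Space.of_injective_continuous coord_injective continuous_coords

instance : CompactSpace (Wedge n) := inferInstanceAs (CompactSpace (Quotient (wedgeSetoid n)))

/-- A map to the wedge is continuous if its coordinates are. -/
theorem continuous_of_coord {Z : Type*} [TopologicalSpace Z] {g : Z → Wedge n}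
    (h : ∀ k, Continuous fun z => coord k (g z)) : Continuous g :=
  ((continuous_coords.isClosedEmbedding coord_injective).isEmbedding.continuous_iff).mpr
    (continuous_pi h)

theorem petal_surjective (x : Wedge n) : ∃ i t, x = petal i t := by
  obtain ⟨i, z, rfl⟩ := exists_mk x
  refine ⟨i, ⟨circleRep 0 z, le_circleRep 0 z, ?_⟩, ?_⟩
  · simpa using (circleRep_lt 0 z).le
  · simp [petal_apply]

theorem petal_eq_petal {i j : Fin n} {s t : I} (h : petal i s = petal j t) :
    (i = j ∧ s = t) ∨ ((s = 0 ∨ s = 1) ∧ (t = 0 ∨ t = 1)) := by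
  have endpoint (s : I) (hs : ((s : ℝ) : UnitAddCircle) = 0) : s = 0 ∨ s = 1 := by
    rcases unitInterval_coe_eq_coe (s := s) (t := 0) (by simpa using hs) with h | h
    · exact Or.inl h
    · exact h.1
  rw [petal_apply, petal_apply, mk_eq_mk] at h
  rcases h with ⟨rfl, h⟩ | ⟨hs, ht⟩
  · rcases unitInterval_coe_eq_coe h with h | h
    · exact Or.inl ⟨rfl, h⟩
    · exact Or.inr h
  · exact Or.inr ⟨endpoint s hs, endpoint t ht⟩

theorem petal_zero (i j : Fin n) : petal i 0 = base j := (petal i).source.trans (base_eq_base i j)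
theorem petal_one (i j : Fin n) : petal i 1 = base j := (petal i).target.trans (base_eq_base i j)

/-- A path that stays off the wedge point inside the circle `j` runs in a petal. -/
theorem exists_eq_petal_comp {j : Fin n} {γ : C(I, Wedge n)} (h : ∀ t, coord j (γ t) ≠ 0) :
    ∃ θ : C(I, I), ∀ t, γ t = petal j (θ t) := by
  refine ⟨⟨fun t => ⟨circleRep 0 (coord j (γ t)), le_circleRep _ _, ?_⟩, ?_⟩, fun t => ?_⟩
  · simpa using (circleRep_lt 0 (coord j (γ t))).le
  · refine Continuous.subtype_mk (continuous_iff_continuousAt.mpr fun t => ?_) _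
    exact (continuousAt_circleRep (by simpa using h t)).comp
      ((continuous_coord j).comp γ.continuous).continuousAt
  · rw [petal_apply]
    simpa using eq_mk_coord (h t)

/-- A path in the star of the wedge point is contracted along the petals. -/
theorem exists_contraction {γ : C(I, Wedge n)}
    (h : ∀ k t, coord k (γ t) ≠ ((-(1 / 2) : ℝ) : UnitAddCircle)) :
    ∃ H : C(I × I, Wedge n), (∀ t, H (0, t) = γ t) ∧ (∀ t j, H (1, t) = base j) ∧
      ∀ t, ∃ j, ∃ θ : C(I, I), ∀ s, H (s, t) = petal j (θ s) := by
  have hγ (t : I) := exists_mk (γ t)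
  choose i z hz using hγ
  -- The choice of `i t` is arbitrary at the wedge point, but the coordinates of the contracted
  -- point do not depend on it; continuity is therefore checked in coordinates.
  have hcoord (k : Fin n) (r : ℝ) (t : I) :
      coord k (mk (i t) ((r * circleRep (-(1 / 2)) (z t) : ℝ) : UnitAddCircle)) =
        ((r * circleRep (-(1 / 2)) (coord k (γ t)) : ℝ) : UnitAddCircle) := by
    have h0 : circleRep (-(1 / 2)) 0 = 0 :=
      circleRep_coe (a := -(1 / 2)) (x := 0) (by norm_num) (by norm_num)
    rw [hz, coord_mk, coord_mk]
    split_ifs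
    · rfl
    · rw [h0, mul_zero, AddCircle.coe_zero]
  refine ⟨⟨fun p => mk (i p.2) (((1 - (p.1 : ℝ)) * circleRep (-(1 / 2)) (z p.2) : ℝ) :
    UnitAddCircle), continuous_of_coord fun k => ?_⟩, fun t => ?_, fun t j => ?_, fun t => ?_⟩
  · simp only [hcoord]
    refine (AddCircle.continuous_mk' 1).comp ?_
    have hc : Continuous fun t => circleRep (-(1 / 2)) (coord k (γ t)) :=
      continuous_iff_continuousAt.mpr fun t =>
        ContinuousAt.comp (f := fun t => coord k (γ t)) (continuousAt_circleRep (h k t))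
          ((continuous_coord k).comp γ.continuous).continuousAt
    have hc' := hc.comp (continuous_snd (X := I) (Y := I))
    exact (continuous_const.sub (continuous_subtype_val.comp continuous_fst)).mul hc'
  · simp [hz]
  · have := base_eq_base (i t) j
    simpa [base] using this
  · have hl := le_circleRep (-(1 / 2)) (z t)
    have hu := circleRep_lt (-(1 / 2)) (z t)
    rcases le_or_gt 0 (circleRep (-(1 / 2)) (z t)) with h0 | h0
    · refine ⟨i t, ⟨fun s => ⟨(1 - (s : ℝ)) * circleRep (-(1 / 2)) (z t), ?_, ?_⟩, by fun_prop⟩,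
        fun s => rfl⟩
      · exact mul_nonneg (sub_nonneg.mpr s.2.2) h0
      · exact mul_le_one₀ (by linarith [s.2.1]) h0 (by linarith)
    -- A negative representative is shifted by one period to become a parameter of the petal.
    · refine ⟨i t, ⟨fun s => ⟨(1 - (s : ℝ)) * circleRep (-(1 / 2)) (z t) + 1, ?_, ?_⟩, by fun_prop⟩,
        fun s => ?_⟩
      · nlinarith [s.2.1, s.2.2]
      · have := mul_nonpos_of_nonneg_of_nonpos (sub_nonneg.mpr s.2.2) h0.le
        linarith
      · rw [petal_apply]
        change mk _ _ = mk _ ((_ + 1 : ℝ) : UnitAddCircle)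
        rw [AddCircle.coe_add_period]

end Wedge

/-! ### Computing with cocycles on paths. -/

section Cocycles

variable {Y V : Type} [TopologicalSpace Y] [AddCommGroup V]
  {κ : C(I, Y) → V}

theorem IsPathCocycle.const (hκ : IsPathCocycle κ) (y : Y) : κ (ContinuousMap.const I y) = 0 := by
  have h := hκ (ContinuousMap.const _ y) (0, 0) (0, 0) (0, 0)
  rw [ContinuousMap.const_comp] at h
  simpa using h

theorem IsPathCocycle.affineI_add (hκ : IsPathCocycle κ) (γ : C(I, Y)) (a b c : I) :
    κ (γ.comp (affineI a b)) + κ (γ.comp (affineI b c)) = κ (γ.comp (affineI a c)) :=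
  hκ (γ.comp ⟨Prod.fst, continuous_fst⟩) (a, 0) (b, 0) (c, 0)

theorem IsPathCocycle.affineI_self (hκ : IsPathCocycle κ) (γ : C(I, Y)) (a : I) :
    κ (γ.comp (affineI a a)) = 0 := by
  simpa using hκ.affineI_add γ a a a

theorem IsPathCocycle.square (hκ : IsPathCocycle κ) (H : C(I × I, Y)) :
    κ (H.comp (segment2 (0, 0) (0, 1))) + κ (H.comp (segment2 (0, 1) (1, 1))) =
      κ (H.comp (segment2 (0, 0) (1, 0))) + κ (H.comp (segment2 (1, 0) (1, 1))) :=
  (hκ H _ _ _).trans (hκ H _ _ _).symm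

theorem segment2_left (t : I) : segment2 (0, 0) (0, 1) t = (0, t) := by
  simp [segment2_apply, affineI_zero_one]
theorem segment2_right (t : I) : segment2 (1, 0) (1, 1) t = (1, t) := by
  simp [segment2_apply, affineI_zero_one]
theorem segment2_bottom (t : I) : segment2 (0, 0) (1, 0) t = (t, 0) := by
  simp [segment2_apply, affineI_zero_one]
theorem segment2_top (t : I) : segment2 (0, 1) (1, 1) t = (t, 1) := by
  simp [segment2_apply, affineI_zero_one]

theorem IsPathCocycle.sub {κ' : C(I, Y) → V} (hκ : IsPathCocycle κ) (hκ' : IsPathCocycle κ') :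
    IsPathCocycle fun γ => κ γ - κ' γ := fun H p q r => by
  simp only [← hκ H p q r, ← hκ' H p q r]
  abel

theorem IsPathCocycle.sum {ι : Type} [Fintype ι] {κ : ι → C(I, Y) → V}
    (hκ : ∀ i, IsPathCocycle (κ i)) : IsPathCocycle fun γ => ∑ i, κ i γ := fun H p q r => by
  simp only [← fun i => hκ i H p q r, Finset.sum_add_distrib]

theorem IsPathCocycle.smul_const [Module ℚ V] {κ : C(I, Y) → ℚ} (hκ : IsPathCocycle κ) (v : V) :
    IsPathCocycle fun γ => κ γ • v := fun H p q r => by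
  simp only [← hκ H p q r, add_smul]

/-- A cocycle that vanishes on small pieces of a path vanishes on the path. -/
theorem IsPathCocycle.eq_zero_of_cover (hκ : IsPathCocycle κ) (γ : C(I, Y)) {ι : Type*}
    {c : ι → Set I} (ho : ∀ i, IsOpen (c i)) (hc : ∀ t, ∃ i, t ∈ c i)
    (h : ∀ i a b, Set.Icc a b ⊆ c i → a ≤ b → κ (γ.comp (affineI a b)) = 0) : κ γ = 0 := by
  obtain ⟨t, t_0, t_mono, ⟨m, hm⟩, t_sub⟩ :=
    exists_monotone_Icc_subset_open_cover_unitInterval ho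
      (fun s _ => Set.mem_iUnion.mpr (hc s))
  have key (k : ℕ) : κ (γ.comp (affineI 0 (t k))) = 0 := by
    induction k with
    | zero => rw [t_0]; exact hκ.affineI_self γ 0
    | succ k ih =>
      obtain ⟨i, hi⟩ := t_sub k
      rw [← hκ.affineI_add γ 0 (t k), ih, zero_add]
      exact h i _ _ hi (t_mono k.le_succ)
  have := key m
  rwa [hm m le_rfl, affineI_zero_one] at this

theorem affineI_mem_Icc {a b : I} (h : a ≤ b) (t : I) : affineI a b t ∈ Set.Icc a b :=
  ⟨Set.Icc.le_convexComb h t, Set.Icc.convexComb_le h t⟩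

/-- A cocycle on a reparametrized path. -/
theorem IsPathCocycle.comp_reparam (hκ : IsPathCocycle κ) (γ : C(I, Y)) (θ : C(I, I)) :
    κ (γ.comp θ) = κ (γ.comp (affineI 0 (θ 1))) - κ (γ.comp (affineI 0 (θ 0))) := by
  -- Scaling `θ` down to `0` gives a square with sides `γ ∘ θ`, a constant path, and the initial
  -- segments of `γ` up to `θ 0` and `θ 1`.
  let H : C(I × I, Y) := γ.comp ⟨fun p => p.1 * θ p.2, by fun_prop⟩
  have h := hκ.square H
  have h1 : H.comp (segment2 (0, 0) (0, 1)) = ContinuousMap.const I (γ 0) :=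
    ContinuousMap.ext fun t => by
      rw [ContinuousMap.comp_apply, segment2_left]
      simp [H]
  have h2 : H.comp (segment2 (1, 0) (1, 1)) = γ.comp θ :=
    ContinuousMap.ext fun t => by
      rw [ContinuousMap.comp_apply, segment2_right]
      simp [H]
  have h3 : H.comp (segment2 (0, 0) (1, 0)) = γ.comp (affineI 0 (θ 0)) :=
    ContinuousMap.ext fun t => by
      rw [ContinuousMap.comp_apply, segment2_bottom]
      refine congrArg γ (Subtype.ext ?_)
      simp [affineI]
  have h4 : H.comp (segment2 (0, 1) (1, 1)) = γ.comp (affineI 0 (θ 1)) :=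
    ContinuousMap.ext fun t => by
      rw [ContinuousMap.comp_apply, segment2_top]
      refine congrArg γ (Subtype.ext ?_)
      simp [affineI]
  rw [h1, h2, h3, h4, hκ.const, zero_add] at h
  rw [h]
  abel

theorem IsPathCocycle.trans (hκ : IsPathCocycle κ) {x y z : Y} (α : Path x y) (β : Path y z) :
    κ (α.trans β).toContinuousMap = κ α.toContinuousMap + κ β.toContinuousMap := by
  let m : I := ⟨1 / 2, by norm_num, by norm_num⟩
  have h := hκ.affineI_add (α.trans β).toContinuousMap 0 m 1
  rw [affineI_zero_one, ContinuousMap.comp_id] at h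
  rw [← h]
  congr 2
  · refine ContinuousMap.ext fun t => ?_
    change (α.trans β) (affineI 0 m t) = α t
    have ht : ((affineI 0 m t : I) : ℝ) = t / 2 := by simp [affineI, m]; ring
    rw [Path.trans_apply, dif_pos (by rw [ht]; linarith [t.2.2])]
    congr 1
    ext
    simp only [ht]
    ring
  · refine ContinuousMap.ext fun t => ?_
    change (α.trans β) (affineI m 1 t) = β t
    have ht : ((affineI m 1 t : I) : ℝ) = (1 + t) / 2 := by simp [affineI, m]; ring
    rw [Path.trans_apply]
    split_ifs with h0
    · have ht0 : (t : ℝ) = 0 := le_antisymm (by rw [ht] at h0; linarith) t.2.1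
      have ht0' : t = 0 := Subtype.ext ht0
      subst ht0'
      rw [β.source]
      convert α.target
      rw [ht]
      simp
    · congr 1
      ext
      simp only [ht]
      ring

end Cocycles

/-! ### Crossing numbers of paths mapped to the circle. -/

section Winding

variable {Y : Type} [TopologicalSpace Y]

theorem exists_real_lift (p : C(I, UnitAddCircle)) :
    ∃ L : C(I, ℝ), ∀ t, (L t : UnitAddCircle) = p t := by
  obtain ⟨L, hL, -⟩ := (AddCircle.isCoveringMap_coe (1 : ℝ)).exists_path_lifts p
    (circleRep 0 (p 0)) (by simp)
  exact ⟨L, congrFun hL⟩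

/-- The number of crossings of the base point of the circle, counted with sign, of the image of a
path under a map to the circle. -/
noncomputable def crossing (p : C(Y, UnitAddCircle)) (γ : C(I, Y)) : ℚ :=
  ((⌊(exists_real_lift (p.comp γ)).choose 1⌋ - ⌊(exists_real_lift (p.comp γ)).choose 0⌋ : ℤ) : ℚ)

/-- Two real lifts differ by a constant integer, which cancels in the difference of floors. -/
theorem crossing_eq {p : C(Y, UnitAddCircle)} {γ : C(I, Y)} {L : I → ℝ} (hL : Continuous L)
    (h : ∀ t, (L t : UnitAddCircle) = p (γ t)) :
    crossing p γ = ((⌊L 1⌋ - ⌊L 0⌋ : ℤ) : ℚ) := by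
  have hL' := (exists_real_lift (p.comp γ)).choose_spec
  rw [crossing]
  generalize (exists_real_lift (p.comp γ)).choose = L' at hL'
  obtain ⟨m, hm⟩ : ∃ m : ℤ, L' 0 = L 0 + m := by
    have h0 : ((L' 0 - L 0 : ℝ) : UnitAddCircle) = 0 := by
      rw [AddCircle.coe_sub, hL', h, ContinuousMap.comp_apply, sub_self]
    obtain ⟨m, hm⟩ := AddCircle.coe_eq_zero_iff (1 : ℝ) |>.mp h0
    refine ⟨m, ?_⟩
    rw [zsmul_one] at hm
    linarith
  have heq : (L' : I → ℝ) = fun t => L t + m := by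
    refine (AddCircle.isCoveringMap_coe (1 : ℝ)).eq_of_comp_eq L'.continuous (by fun_prop) ?_ 0 hm
    funext t
    simp [hL', h]
  rw [heq]
  simp

/-- One real lift of the whole square serves all three segments, and the floors telescope. -/
theorem isPathCocycle_crossing (p : C(Y, UnitAddCircle)) : IsPathCocycle (crossing p) := by
  intro H a b c
  have hcov := AddCircle.isCoveringMap_coe (1 : ℝ)
  obtain ⟨L₀, hL₀⟩ := exists_real_lift ((p.comp H).comp (segment2 (0, 0) (0, 1)))
  have h0 (t : I) : (p.comp H) (0, t) = ((L₀ t : ℝ) : UnitAddCircle) := by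
    rw [hL₀, ContinuousMap.comp_apply (p.comp H), segment2_left]
  have hM := hcov.liftHomotopy_lifts (p.comp H) L₀ h0
  generalize hcov.liftHomotopy (p.comp H) L₀ h0 = M at hM
  have key (a b : I × I) : crossing p (H.comp (segment2 a b)) = ((⌊M b⌋ - ⌊M a⌋ : ℤ) : ℚ) := by
    rw [crossing_eq (p := p) (γ := H.comp (segment2 a b)) (L := M.comp (segment2 a b))
      (ContinuousMap.continuous _) (fun t => congrFun hM (segment2 a b t))]
    simp
  rw [key, key, key]
  push_cast
  ring

end Winding

/-! ### The cover as a graph: vertices, edges, and maps defined edge by edge. -/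

section Covers

open Wedge

variable {n : ℕ} {Y : Type} [TopologicalSpace Y] {f : Y → Wedge n}

/-- The points of the cover over the wedge point. -/
def Vertex (f : Y → Wedge n) : Type := {v : Y // ∀ j, f v = base j}

namespace Vertex

variable (hc : IsCoveringMap f)

/-- The lift of the `j`-th petal that starts at `v`. -/
noncomputable def edge (v : Vertex f) (j : Fin n) : C(I, Y) :=
  hc.liftPath (petal j).toContinuousMap v.1 ((petal j).source.trans (v.2 j).symm)

theorem map_edge (v : Vertex f) (j : Fin n) (t : I) : f (edge hc v j t) = petal j t :=
  congrFun (hc.liftPath_lifts (petal j).toContinuousMap v.1 _) t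

@[simp] theorem edge_zero (v : Vertex f) (j : Fin n) : edge hc v j 0 = v.1 :=
  hc.liftPath_zero _ _ _

/-- The end point of an edge. -/
noncomputable def edgeEnd (v : Vertex f) (j : Fin n) : Vertex f :=
  ⟨edge hc v j 1, fun k => (map_edge hc v j 1).trans (petal_one j k)⟩

theorem edge_one (v : Vertex f) (j : Fin n) : edge hc v j 1 = (edgeEnd hc v j).1 := rfl

include hc in
theorem path_ext {γ γ' : C(I, Y)} (h : ∀ t, f (γ t) = f (γ' t)) (t : I) (ht : γ t = γ' t) :
    γ = γ' :=
  DFunLike.coe_injective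
    (hc.eq_of_comp_eq γ.continuous γ'.continuous (funext h) t ht)

theorem eq_of_edge_eq {v w : Vertex f} {j : Fin n} {t : I} (h : edge hc v j t = edge hc w j t) :
    v = w := by
  have := path_ext hc (fun s => (map_edge hc v j s).trans (map_edge hc w j s).symm) t h
  refine Subtype.ext ?_
  rw [← edge_zero hc v j, this, edge_zero]

theorem exists_edge_eq {y : Y} {j : Fin n} {t : I} (h : f y = petal j t) :
    ∃ v : Vertex f, edge hc v j t = y := by
  have h0 : ((petal j).toContinuousMap.comp (affineI t 0)) 0 = f y := by
    rw [ContinuousMap.comp_apply, affineI_zero]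
    exact h.symm
  have hl := hc.liftPath_lifts _ y h0
  have hz := hc.liftPath_zero _ y h0
  generalize hc.liftPath _ y h0 = γ at hl hz
  have hl' (s : I) : f (γ s) = petal j (affineI t 0 s) := congrFun hl s
  let v : Vertex f := ⟨γ 1, fun k => by rw [hl', affineI_one]; exact petal_zero j k⟩
  refine ⟨v, ?_⟩
  have := path_ext hc (γ := (edge hc v j).comp (affineI t 0)) (γ' := γ) (fun s => by
    rw [hl', ContinuousMap.comp_apply, map_edge hc]) 1
    (by rw [ContinuousMap.comp_apply, affineI_one, edge_zero])
  rw [← hz, ← this]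
  simp

theorem exists_edge (y : Y) : ∃ (v : Vertex f) (j : Fin n) (t : I), y = edge hc v j t := by
  obtain ⟨j, t, h⟩ := petal_surjective (f y)
  obtain ⟨v, rfl⟩ := exists_edge_eq hc h
  exact ⟨v, j, t, rfl⟩

/-- A cocycle that vanishes on the initial segments of all edges is zero. -/
theorem cocycle_eq_zero {V : Type} [AddCommGroup V] {κ : C(I, Y) → V} (hκ : IsPathCocycle κ)
    (h : ∀ (v : Vertex f) (j : Fin n) (a : I), κ ((edge hc v j).comp (affineI 0 a)) = 0)
    (γ : C(I, Y)) : κ γ = 0 := by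
  have hf := hc.continuous
  -- By uniqueness of lifts such a path is a reparametrized edge.
  have petal_case (γ : C(I, Y)) (j : Fin n) (θ : C(I, I)) (hγ : ∀ t, f (γ t) = petal j (θ t)) :
      κ γ = 0 := by
    obtain ⟨v, hv⟩ := exists_edge_eq hc (hγ 0)
    have : γ = (edge hc v j).comp θ :=
      path_ext hc (fun t => by rw [hγ, ContinuousMap.comp_apply, map_edge hc]) 0 hv.symm
    rw [this, hκ.comp_reparam, h, h, sub_self]
  -- The contraction of the star is lifted to `Y`; the other three sides of the lifted square lie
  -- over petals.
  have star_case (γ : C(I, Y))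
      (hγ : ∀ k t, coord k (f (γ t)) ≠ ((-(1 / 2) : ℝ) : UnitAddCircle)) : κ γ = 0 := by
    obtain ⟨H, H0, H1, Hs⟩ := exists_contraction (γ := (⟨f, hf⟩ : C(Y, Wedge n)).comp γ) hγ
    have hM := hc.liftHomotopy_lifts H γ H0
    have hM0 := hc.liftHomotopy_zero H γ H0
    generalize hc.liftHomotopy H γ H0 = M at hM hM0
    have hM' (p : I × I) : f (M p) = H p := congrFun hM p
    have hsq := hκ.square M
    have e1 : M.comp (segment2 (0, 0) (0, 1)) = γ := ContinuousMap.ext fun t => by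
      rw [ContinuousMap.comp_apply, segment2_left, hM0]
    have e2 : κ (M.comp (segment2 (0, 1) (1, 1))) = 0 := by
      obtain ⟨j, θ, hθ⟩ := Hs 1
      exact petal_case _ j θ fun s => by
        rw [ContinuousMap.comp_apply, segment2_top, hM', hθ]
    have e3 : κ (M.comp (segment2 (0, 0) (1, 0))) = 0 := by
      obtain ⟨j, θ, hθ⟩ := Hs 0
      exact petal_case _ j θ fun s => by
        rw [ContinuousMap.comp_apply, segment2_bottom, hM', hθ]
    have e4 : κ (M.comp (segment2 (1, 0) (1, 1))) = 0 := by
      obtain ⟨j, -⟩ := Hs 0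
      exact petal_case _ j (ContinuousMap.const I 0) fun s => by
        rw [ContinuousMap.comp_apply, segment2_right, hM', H1]
        exact (petal_zero j j).symm
    rw [e1, e2, e3, e4] at hsq
    simpa using hsq
  -- The piece `none` avoids the midpoints of all circles; the piece `some j` stays in circle `j`
  -- off the wedge point.
  let c : Option (Fin n) → Set I
    | none => {t | ∀ k, coord k (f (γ t)) ≠ ((-(1 / 2) : ℝ) : UnitAddCircle)}
    | some j => {t | coord j (f (γ t)) ≠ 0}
  have hcont (k : Fin n) : Continuous fun t => coord k (f (γ t)) :=
    (continuous_coord k).comp (hf.comp γ.continuous)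
  refine hκ.eq_zero_of_cover γ (c := c) ?_ ?_ ?_
  · rintro (_ | j)
    · simp only [c, Set.ofPred_forall]
      exact isOpen_iInter_of_finite fun k => isOpen_ne_fun (hcont k) continuous_const
    · exact isOpen_ne_fun (hcont j) continuous_const
  · intro t
    by_cases ht : ∃ j, coord j (f (γ t)) ≠ 0
    · obtain ⟨j, hj⟩ := ht
      exact ⟨some j, hj⟩
    · push Not at ht
      refine ⟨none, fun k => ?_⟩
      rw [ht]
      intro h0
      have := (unitInterval_coe_eq_coe (s := 0) (t := ⟨1 / 2, by norm_num, by norm_num⟩) (by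
        have h1 := AddCircle.coe_add_period (1 : ℝ) (-(1 / 2))
        rw [← h0] at h1
        simp only [Set.Icc.coe_zero, AddCircle.coe_zero]
        rw [← h1]
        norm_num))
      simp [Subtype.ext_iff] at this
  · rintro (_ | j) a b hab hle
    · exact star_case _ fun k t => hab (affineI_mem_Icc hle t) k
    · obtain ⟨θ, hθ⟩ := exists_eq_petal_comp (j := j)
        (γ := ((⟨f, hf⟩ : C(Y, Wedge n)).comp γ).comp (affineI a b))
        fun t => hab (affineI_mem_Icc hle t)
      exact petal_case _ j θ hθ

/-- Functions on the cover are given by compatible functions on the edges. -/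
theorem exists_function_of_edges {Z : Type*} (ψ : Vertex f → Z) (φ : Vertex f → Fin n → I → Z)
    (h0 : ∀ v j, φ v j 0 = ψ v) (h1 : ∀ v j, φ v j 1 = ψ (edgeEnd hc v j)) :
    ∃ g : Y → Z, ∀ v j t, g (edge hc v j t) = φ v j t := by
  choose v j t hvjt using exists_edge hc
  refine ⟨fun y => φ (v y) (j y) (t y), fun w k s => ?_⟩
  have h := hvjt (edge hc w k s)
  have hf := congrArg f h
  rw [map_edge hc, map_edge hc] at hf
  beta_reduce
  generalize v (edge hc w k s) = v at h
  generalize j (edge hc w k s) = j at h hf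
  generalize t (edge hc w k s) = t at h hf
  -- Two descriptions of one point either agree or are both end points of edges, where `ψ` decides
  -- the value.
  rcases petal_eq_petal hf with ⟨rfl, rfl⟩ | ⟨hs, ht⟩
  · rw [eq_of_edge_eq hc h]
  · have endpoint (v : Vertex f) (j : Fin n) (t : I) (ht : t = 0 ∨ t = 1) :
        ∃ u : Vertex f, u.1 = edge hc v j t ∧ φ v j t = ψ u := by
      rcases ht with rfl | rfl
      · exact ⟨v, (edge_zero hc v j).symm, h0 v j⟩
      · exact ⟨edgeEnd hc v j, rfl, h1 v j⟩
    obtain ⟨u, hu, hu'⟩ := endpoint v j t ht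
    obtain ⟨u', hu2, hu2'⟩ := endpoint w k s hs
    rw [hu', hu2', Subtype.ext (hu.trans (h.symm.trans hu2.symm))]

include hc in
-- Hausdorffness makes the map from the compact union of edges closed, hence a quotient map.
theorem t2Space : T2Space Y := by
  refine ⟨fun y y' hne => ?_⟩
  by_cases h : f y = f y'
  · exact hc.isSeparatedMap y y' h hne
  · obtain ⟨u, w, hu, hw, hyu, hyw, huw⟩ := t2_separation h
    exact ⟨f ⁻¹' u, f ⁻¹' w, hu.preimage hc.continuous, hw.preimage hc.continuous, hyu, hyw,
      huw.preimage f⟩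

instance : TopologicalSpace (Vertex f) := ⊥
instance : DiscreteTopology (Vertex f) := ⟨rfl⟩

/-- The cover is a quotient of the disjoint union of its edges. -/
theorem isQuotientMap_edge [Finite (Vertex f)] :
    Topology.IsQuotientMap fun p : (Vertex f × Fin n) × I => edge hc p.1.1 p.1.2 p.2 := by
  have := t2Space hc
  have hcont : Continuous fun p : (Vertex f × Fin n) × I => edge hc p.1.1 p.1.2 p.2 :=
    continuous_prod_of_discrete_left.mpr fun e => (edge hc e.1 e.2).continuous
  refine hcont.isClosedMap.isQuotientMap hcont fun y => ?_
  obtain ⟨v, j, t, rfl⟩ := exists_edge hc y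
  exact ⟨((v, j), t), rfl⟩

/-- Continuous maps on the cover are given by compatible maps on the edges. -/
theorem exists_map_of_edges [Finite (Vertex f)] {Z : Type*} [TopologicalSpace Z]
    (ψ : Vertex f → Z) (φ : Vertex f → Fin n → C(I, Z))
    (h0 : ∀ v j, φ v j 0 = ψ v) (h1 : ∀ v j, φ v j 1 = ψ (edgeEnd hc v j)) :
    ∃ g : C(Y, Z), ∀ v j t, g (edge hc v j t) = φ v j t := by
  obtain ⟨g, hg⟩ := exists_function_of_edges hc ψ (fun v j t => φ v j t) h0 h1
  refine ⟨⟨g, (isQuotientMap_edge hc).continuous_iff.mpr ?_⟩, hg⟩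
  refine continuous_prod_of_discrete_left.mpr fun e => ?_
  have : (fun t => (g ∘ fun p : (Vertex f × Fin n) × I => edge hc p.1.1 p.1.2 p.2) (e, t)) =
      φ e.1 e.2 := funext fun t => hg e.1 e.2 t
  rw [this]
  exact (φ e.1 e.2).continuous

end Vertex

end Covers

open Wedge

/-! ### Edge coefficients of homology classes and lifts of words. -/

namespace Vertex

variable {n : ℕ} {Y : Type} [TopologicalSpace Y] {f : Y → Wedge n} (hc : IsCoveringMap f)

noncomputable instance : DecidableEq (Vertex f) := Classical.decEq _

/-- The path that runs once around the circle. -/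
def circleLoop : C(I, UnitAddCircle) :=
  ⟨fun t : I => ((t : ℝ) : UnitAddCircle),
    (AddCircle.continuous_mk' 1).comp continuous_subtype_val⟩

theorem circleLoop_apply (t : I) : circleLoop t = ((t : ℝ) : UnitAddCircle) := rfl

/-- Wrapping `e` once around the circle and collapsing all other edges makes the coefficient of `e`
a crossing number. -/
theorem exists_collapse [Finite (Vertex f)] (e : Vertex f × Fin n) :
    ∃ p : C(Y, UnitAddCircle), ∀ w k t,
      p (edge hc w k t) = if (w, k) = e then ((t : ℝ) : UnitAddCircle) else 0 := by
  obtain ⟨p, hp⟩ := exists_map_of_edges hc (fun _ => (0 : UnitAddCircle))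
    (fun w k => if (w, k) = e then circleLoop else ContinuousMap.const I 0)
    (fun w k => by split_ifs <;> simp [circleLoop_apply])
    (fun w k => by
      have h : ((1 : ℝ) : UnitAddCircle) = 0 := AddCircle.coe_period 1
      split_ifs <;> simp [circleLoop_apply, h])
  refine ⟨p, fun w k t => ?_⟩
  rw [hp]
  split_ifs <;> simp [circleLoop_apply]

/-- The coefficient of an edge in a path. -/
noncomputable def coeff [Finite (Vertex f)] (e : Vertex f × Fin n) : C(I, Y) → ℚ :=
  crossing (exists_collapse hc e).choose

theorem isPathCocycle_coeff [Finite (Vertex f)] (e : Vertex f × Fin n) :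
    IsPathCocycle (coeff hc e) := isPathCocycle_crossing _

/-- The floor jumps only at the end of the edge, so a proper initial segment counts zero. -/
theorem coeff_initial [Finite (Vertex f)] (e : Vertex f × Fin n) (w : Vertex f) (k : Fin n)
    (a : I) : coeff hc e ((edge hc w k).comp (affineI 0 a)) =
      if (w, k) = e ∧ a = 1 then 1 else 0 := by
  have h := (exists_collapse hc e).choose_spec w k
  by_cases hw : (w, k) = e
  · simp only [if_pos hw] at h
    rw [coeff, crossing_eq (L := fun t => (affineI 0 a t : ℝ)) (by fun_prop)
      fun t => (h (affineI 0 a t)).symm]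
    by_cases ha : a = 1
    · simp [hw, ha]
    · have ha1 : (a : ℝ) < 1 := lt_of_le_of_ne a.2.2 fun h => ha (Subtype.ext h)
      have : ⌊(a : ℝ)⌋ = 0 := Int.floor_eq_zero_iff.mpr ⟨a.2.1, ha1⟩
      simp [ha, this]
  · simp only [if_neg hw] at h
    rw [coeff, crossing_eq (L := fun _ => 0) (by fun_prop)
      fun t => by simpa using (h (affineI 0 a t)).symm]
    simp [hw]

theorem coeff_edge [Finite (Vertex f)] (e : Vertex f × Fin n) (w : Vertex f) (k : Fin n) :
    coeff hc e (edge hc w k) = if (w, k) = e then 1 else 0 := by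
  have := coeff_initial hc e w k 1
  rw [affineI_zero_one, ContinuousMap.comp_id] at this
  simpa using this

/-- Every path is a combination of edges, up to a function of its end points. -/
theorem exists_pathClass_eq [Fintype (Vertex f)] :
    ∃ r : Y → ChainsModBoundaries Y, ∀ γ : C(I, Y), pathClass γ =
      ∑ e, coeff hc e γ • pathClass (edge hc e.1 e.2) + (r (γ 1) - r (γ 0)) := by
  have hθ := isPathCocycle_pathClass (Y := Y)
  -- `r` is the class of the initial segment of the edge up to the point. It is reset to `0` at `t =
  -- 1`, where the point is a vertex and the coefficient takes over.
  obtain ⟨r, hr⟩ := exists_function_of_edges hc (fun _ => (0 : ChainsModBoundaries Y))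
    (fun v j t => if t = 1 then 0 else pathClass ((edge hc v j).comp (affineI 0 t)))
    (fun v j => by simp [hθ.affineI_self]) (fun v j => by simp)
  refine ⟨r, fun γ => ?_⟩
  have hκ := (hθ.sub (IsPathCocycle.sum fun e : Vertex f × Fin n =>
    (isPathCocycle_coeff hc e).smul_const (pathClass (edge hc e.1 e.2)))).sub
      (isPathCocycle_boundary r)
  have := cocycle_eq_zero hc hκ (fun v j a => ?_) γ
  · rw [sub_sub, sub_eq_zero] at this
    exact this
  · simp only [coeff_initial, ContinuousMap.comp_apply, affineI_zero, affineI_one, hr]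
    by_cases ha : a = 1
    · subst ha
      simp [hθ.affineI_self, affineI_zero_one]
    · simp [hθ.affineI_self, ha]

/-- The coefficient of an edge in a homology class. -/
noncomputable def homologyCoeff [Finite (Vertex f)] (e : Vertex f × Fin n) : H1 Y →ₗ[ℚ] ℚ :=
  (isPathCocycle_coeff hc e).linearMap ∘ₗ homologyIncl Y

theorem homologyIncl_eq_sum [Fintype (Vertex f)] (x : H1 Y) :
    homologyIncl Y x = ∑ e, homologyCoeff hc e x • pathClass (edge hc e.1 e.2) := by
  obtain ⟨r, hr⟩ := exists_pathClass_eq hc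
  have h : (LinearMap.id : ChainsModBoundaries Y →ₗ[ℚ] ChainsModBoundaries Y) =
      ∑ e, (isPathCocycle_coeff hc e).linearMap.smulRight (pathClass (edge hc e.1 e.2)) +
        (isPathCocycle_boundary r).linearMap :=
    ChainsModBoundaries.linearMap_ext fun γ => by
      rw [LinearMap.id_apply, LinearMap.add_apply, LinearMap.sum_apply]
      simp only [LinearMap.smulRight_apply, IsPathCocycle.linearMap_pathClass]
      exact hr γ
  have := LinearMap.congr_fun h (homologyIncl Y x)
  rw [LinearMap.id_apply, LinearMap.add_apply, boundary_linearMap_homologyIncl, add_zero,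
    LinearMap.sum_apply] at this
  exact this

/-- A nonzero homology class has a nonzero coefficient. -/
theorem exists_homologyCoeff_ne_zero [Finite (Vertex f)] {x : H1 Y} (hx : x ≠ 0) :
    ∃ e, homologyCoeff hc e x ≠ 0 := by
  have := Fintype.ofFinite (Vertex f)
  by_contra! h
  refine hx (homologyIncl_injective ?_)
  rw [homologyIncl_eq_sum hc, map_zero]
  simp [h]

/-- The edge as a path between vertices. -/
noncomputable def edgePath (v : Vertex f) (j : Fin n) : Path v.1 (edgeEnd hc v j).1 :=
  ⟨edge hc v j, edge_zero hc v j, rfl⟩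

variable {i : Fin n}

/-- The end point of the lift of a word in the petals. -/
noncomputable def wordEnd : Vertex f → List {j : Fin n // j ≠ i} → Vertex f
  | v, [] => v
  | v, j :: w => wordEnd (edgeEnd hc v j) w

/-- The lift of a word in the petals. -/
noncomputable def wordLift : (v : Vertex f) → (w : List {j : Fin n // j ≠ i}) →
    Path v.1 (wordEnd hc v w).1
  | v, [] => Path.refl v.1
  | v, j :: w => (edgePath hc v j).trans (wordLift (edgeEnd hc v j) w)

theorem coeff_wordLift_nil [Finite (Vertex f)] (e : Vertex f × Fin n) (v : Vertex f) :
    coeff hc e (wordLift hc v ([] : List {j : Fin n // j ≠ i})).toContinuousMap = 0 :=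
  (isPathCocycle_coeff hc e).const v.1

theorem coeff_wordLift_cons [Finite (Vertex f)] (e : Vertex f × Fin n) (v : Vertex f)
    (j : {j : Fin n // j ≠ i}) (w : List {j : Fin n // j ≠ i}) :
    coeff hc e (wordLift hc v (j :: w)).toContinuousMap =
      (if (v, j.1) = e then 1 else 0) +
        coeff hc e (wordLift hc (edgeEnd hc v j) w).toContinuousMap := by
  rw [← coeff_edge hc e]
  exact (isPathCocycle_coeff hc e).trans (edgePath hc v j) (wordLift hc (edgeEnd hc v j) w)

/-- The words omit the letter `i`; this is what makes the slide unipotent on homology. -/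
theorem coeff_wordLift_self [Finite (Vertex f)] (u v : Vertex f)
    (w : List {j : Fin n // j ≠ i}) :
    coeff hc (u, i) (wordLift hc v w).toContinuousMap = 0 := by
  induction w generalizing v with
  | nil => exact coeff_wordLift_nil hc _ v
  | cons j w ih =>
    rw [coeff_wordLift_cons, ih, if_neg (by simp [j.2]), add_zero]

end Vertex

/-! ### Edge slides of the wedge are homotopy equivalences. -/

namespace Wedge

variable {n : ℕ} {i : Fin n}

/-- The loop at the wedge point that spells a word in the petals. -/
noncomputable def wordLoop (i : Fin n) : List {j : Fin n // j ≠ i} → Path (base i) (base i)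
  | [] => Path.refl _
  | j :: w => ((petal j.1).cast (base_eq_base i j) (base_eq_base i j)).trans (wordLoop i w)

theorem trans_apply_eq {X Z : Type*} [TopologicalSpace X] [TopologicalSpace Z] {x y z : X}
    {x' y' z' : Z} {α : Path x y} {β : Path y z} {α' : Path x' y'} {β' : Path y' z'} {g : X → Z}
    (hα : ∀ t, g (α t) = α' t) (hβ : ∀ t, g (β t) = β' t) (t : I) :
    g (α.trans β t) = α'.trans β' t := by
  rw [Path.trans_apply, Path.trans_apply]
  split_ifs
  · exact hα _
  · exact hβ _

theorem trans_apply_mem {X : Type*} [TopologicalSpace X] {x y z : X} {α : Path x y} {β : Path y z}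
    {P : X → Prop} (hα : ∀ t, P (α t)) (hβ : ∀ t, P (β t)) (t : I) : P (α.trans β t) := by
  rw [Path.trans_apply]
  split_ifs
  · exact hα _
  · exact hβ _

theorem map_wordLift {Y : Type} [TopologicalSpace Y] {f : Y → Wedge n} (hc : IsCoveringMap f)
    (v : Vertex f) (w : List {j : Fin n // j ≠ i}) (t : I) :
    f (Vertex.wordLift hc v w t) = wordLoop i w t := by
  induction w generalizing v t with
  | nil => exact v.2 i
  | cons j w ih => exact trans_apply_eq (fun t => Vertex.map_edge hc v j t) (fun t => ih _ t) t

theorem wordLoop_avoids {k : Fin n} (hk : k ≠ i) (w : List {j : Fin n // j ≠ i}) (t : I) :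
    ∃ j, j ≠ i ∧ ∃ z, wordLoop i w t = mk j z := by
  induction w generalizing t with
  | nil => exact ⟨k, hk, 0, base_eq_base i k⟩
  | cons j w ih =>
    exact trans_apply_mem (P := fun x => ∃ j, j ≠ i ∧ ∃ z, x = mk j z)
      (fun t => ⟨j, j.2, _, rfl⟩) ih t

/-- Continuous maps on the wedge are given by loops. -/
theorem exists_map {Z : Type*} [TopologicalSpace Z] (z : Z) (φ : Fin n → C(I, Z))
    (h0 : ∀ j, φ j 0 = z) (h1 : ∀ j, φ j 1 = z) :
    ∃ g : C(Wedge n, Z), ∀ j t, g (petal j t) = φ j t := by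
  -- The wedge is treated as its own trivial cover, with a single vertex.
  have hc : IsCoveringMap (id : Wedge n → Wedge n) := 
    isLocalHomeomorph_iff_isCoveringMap.mp (Homeomorph.refl _).isLocalHomeomorph
  rcases isEmpty_or_nonempty (Fin n) with he | ⟨⟨j₀⟩⟩
  · have : IsEmpty (Wedge n) := ⟨fun x => he.elim (exists_mk x).choose⟩
    exact ⟨⟨fun x => isEmptyElim x, continuous_of_const fun x => isEmptyElim x⟩,
      fun j => he.elim j⟩
  have hsub : Subsingleton (Vertex (id : Wedge n → Wedge n)) :=
    ⟨fun a b => Subtype.ext ((a.2 j₀).trans (b.2 j₀).symm)⟩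
  let v : Vertex (id : Wedge n → Wedge n) := ⟨base j₀, base_eq_base j₀⟩
  obtain ⟨g, hg⟩ := Vertex.exists_map_of_edges hc (fun _ => z) (fun _ => φ) (fun _ => h0)
    (fun _ => h1)
  refine ⟨g, fun j t => ?_⟩
  rw [← hg v j t]
  exact congrArg g (Vertex.map_edge hc v j t).symm

/-- Maps that agree on all petals but one, and are homotopic there, are homotopic. -/
theorem homotopic_of_petal {Z : Type*} [TopologicalSpace Z] {g h : C(Wedge n, Z)}
    (hj : ∀ j, j ≠ i → ∀ t, g (petal j t) = h (petal j t))
    (hi : (g.comp (petal i).toContinuousMap).HomotopicRel (h.comp (petal i).toContinuousMap)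
      {0, 1}) : g.Homotopic h := by
  obtain ⟨H⟩ := hi
  have hH0 (s : I) : H (s, 0) = g (base i) := by
    rw [H.eq_fst s (by simp)]
    exact congrArg g (petal i).source
  have hH1 (s : I) : H (s, 1) = g (base i) := by
    rw [H.eq_fst s (by simp)]
    exact congrArg g (petal i).target
  -- The homotopy is built as one map from the wedge to the space of paths in `Z`, which reduces its
  -- continuity to the petals.
  obtain ⟨K, hK⟩ := exists_map (ContinuousMap.const I (g (base i)))
    (fun j => if j = i then (H.toContinuousMap.comp ContinuousMap.prodSwap).curry else
      ContinuousMap.curry ⟨fun p : I × I => g (petal j p.1), by fun_prop⟩)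
    (fun j => by
      split_ifs
      · ext s
        simpa using hH0 s
      · ext s
        simpa using congrArg g (petal_zero j i))
    (fun j => by
      split_ifs
      · ext s
        simpa using hH1 s
      · ext s
        simpa using congrArg g (petal_one j i))
  refine ⟨⟨⟨fun p => K p.2 p.1, by fun_prop⟩, fun x => ?_, fun x => ?_⟩⟩
  · obtain ⟨j, t, rfl⟩ := petal_surjective x
    change K (petal j t) 0 = _
    rw [hK]
    split_ifs with h
    · subst h
      exact H.apply_zero t
    · rfl
  · obtain ⟨j, t, rfl⟩ := petal_surjective x
    change K (petal j t) 1 = _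
    rw [hK]
    split_ifs with h
    · subst h
      exact H.apply_one t
    · exact hj j h t

theorem exists_isEdgeSlide {ℓ : Path (base i) (base i)}
    (hℓ : ∀ t, ∃ j, j ≠ i ∧ ∃ z, ℓ t = mk j z) : ∃ F, IsEdgeSlide i ℓ F := by
  obtain ⟨F, hF⟩ := exists_map (base i)
    (fun j => if j = i then (ℓ.trans (petal i)).toContinuousMap else (petal j).toContinuousMap)
    (fun j => by
      split_ifs
      · exact (ℓ.trans (petal i)).source
      · exact petal_zero j i)
    (fun j => by
      split_ifs
      · exact (ℓ.trans (petal i)).target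
      · exact petal_one j i)
  refine ⟨F, hℓ, fun j hj z => ?_, fun t => ?_⟩
  · have hz : mk j z = petal j ⟨circleRep 0 z, le_circleRep 0 z, by
        simpa using (circleRep_lt 0 z).le⟩ := by simp [petal_apply]
    rw [hz, hF, if_neg hj]
    rfl
  · rw [hF, if_pos rfl]
    rfl

/-- Since `ℓ` avoids `a_i`, it is fixed by `F'`, so the composite sends `a_i` to `ℓ * (ℓ' * a_i)`.
-/
theorem IsEdgeSlide.comp_homotopic_id {ℓ ℓ' : Path (base i) (base i)} {F F' : C(Wedge n, Wedge n)}
    (hF : IsEdgeSlide i ℓ F) (hF' : IsEdgeSlide i ℓ' F')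
    (h : (ℓ.trans ℓ').Homotopic (Path.refl _)) :
    (F'.comp F).Homotopic (ContinuousMap.id _) := by
  refine homotopic_of_petal (i := i) (fun j hj t => ?_) ?_
  · rw [petal_apply, ContinuousMap.comp_apply, hF.fixes j hj, hF'.fixes j hj]
    rfl
  · have e : (F'.comp F).comp (petal i).toContinuousMap =
        (ℓ.trans (ℓ'.trans (petal i))).toContinuousMap := by
      refine ContinuousMap.ext fun t => ?_
      change F' (F (petal i t)) = (ℓ.trans (ℓ'.trans (petal i))) t
      rw [hF.slides]
      refine trans_apply_eq (fun t => ?_) hF'.slides t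
      obtain ⟨j, hj, z, hz⟩ := hF.avoids t
      rw [hz, hF'.fixes j hj]
    rw [e]
    have h1 : (ℓ.trans (ℓ'.trans (petal i))).Homotopic (petal i) :=
      (Path.Homotopic.symm ⟨Path.Homotopy.transAssoc ℓ ℓ' (petal i)⟩).trans
        ((h.hcomp (Path.Homotopic.refl (petal i))).trans ⟨Path.Homotopy.reflTrans (petal i)⟩)
    exact h1

/-- An edge slide is a homotopy equivalence. -/
theorem exists_homotopyEquiv {ℓ : Path (base i) (base i)}
    (hℓ : ∀ t, ∃ j, j ≠ i ∧ ∃ z, ℓ t = mk j z) :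
    ∃ F : Wedge n ≃ₕ Wedge n, IsEdgeSlide i ℓ F.toFun := by
  obtain ⟨F, hF⟩ := exists_isEdgeSlide hℓ
  obtain ⟨F', hF'⟩ := exists_isEdgeSlide (ℓ := ℓ.symm) fun t => hℓ _
  refine ⟨⟨F, F', hF.comp_homotopic_id hF' ?_, hF'.comp_homotopic_id hF ?_⟩, hF⟩
  · exact Path.Homotopic.symm ⟨Path.Homotopy.reflTransSymm ℓ⟩
  · exact Path.Homotopic.symm ⟨Path.Homotopy.reflSymmTrans ℓ⟩

end Wedge

/-! ### Lifted slides, their action on homology, and the deck group. -/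

namespace Vertex

variable {n : ℕ} {Y : Type} [TopologicalSpace Y] {f : Y → Wedge n} (hc : IsCoveringMap f)
  {i : Fin n}

/-- The lift of a word with closed lifts, as a loop. -/
noncomputable def loopLift {w : List {j : Fin n // j ≠ i}} (hw : ∀ v, wordEnd hc v w = v)
    (v : Vertex f) : Path v.1 v.1 :=
  (wordLift hc v w).cast rfl (congrArg Subtype.val (hw v).symm)

theorem toContinuousMap_loopLift {w : List {j : Fin n // j ≠ i}} (hw : ∀ v, wordEnd hc v w = v)
    (v : Vertex f) : (loopLift hc hw v).toContinuousMap = (wordLift hc v w).toContinuousMap := rfl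

/-- An edge slide along a word with closed lifts lifts to the cover. -/
theorem exists_slide_lift [Finite (Vertex f)] {w : List {j : Fin n // j ≠ i}}
    (hw : ∀ v, wordEnd hc v w = v) : ∃ Ft : C(Y, Y), (∀ v j, j ≠ i → ∀ t,
      Ft (edge hc v j t) = edge hc v j t) ∧
      ∀ v t, Ft (edge hc v i t) = ((loopLift hc hw v).trans (edgePath hc v i)) t := by
  obtain ⟨Ft, hFt⟩ := exists_map_of_edges hc (fun v => v.1)
    (fun v j => if j = i then ((loopLift hc hw v).trans (edgePath hc v i)).toContinuousMap else
      edge hc v j)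
    (fun v j => by
      split_ifs
      · exact Path.source _
      · exact edge_zero hc v j)
    (fun v j => by
      split_ifs with h
      · subst h
        exact Path.target _
      · exact edge_one hc v j)
  refine ⟨Ft, fun v j hj t => ?_, fun v t => ?_⟩
  · rw [hFt, if_neg hj]
  · rw [hFt, if_pos rfl]
    rfl

section SlideLift

variable {w : List {j : Fin n // j ≠ i}} {hw : ∀ v, wordEnd hc v w = v} {Ft : C(Y, Y)}
  (hfix : ∀ v j, j ≠ i → ∀ t, Ft (edge hc v j t) = edge hc v j t)
  (hslide : ∀ v t, Ft (edge hc v i t) = ((loopLift hc hw v).trans (edgePath hc v i)) t)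
include hfix hslide

omit hfix in
theorem slide_lift_vertex (v : Vertex f) : Ft v.1 = v.1 := by
  have := hslide v 0
  rwa [edge_zero, Path.source] at this

/-- For a deck transformation `g`, both `Ft ∘ g` and `g ∘ Ft` lift `F ∘ f`, and they agree at a
vertex because `Ft` fixes every vertex. -/
theorem slide_lift_isLift [ConnectedSpace Y] {F : C(Wedge n, Wedge n)}
    (hF : IsEdgeSlide i (wordLoop i w) F) : IsLiftTrivialOnDeck f F Ft := by
  have hl (y : Y) : f (Ft y) = F (f y) := by
    obtain ⟨v, j, t, rfl⟩ := exists_edge hc y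
    rw [map_edge hc]
    by_cases hj : j = i
    · subst hj
      rw [hslide, hF.slides]
      exact trans_apply_eq (g := f) (α := loopLift hc hw v) (β := edgePath hc v j) (fun t => map_wordLift hc v w t)
        (fun t => map_edge hc v j t) t
    · rw [hfix v j hj, map_edge hc, petal_apply, hF.fixes j hj]
  refine ⟨hl, fun g hg y => ?_⟩
  obtain ⟨y₀⟩ := (inferInstance : Nonempty Y)
  obtain ⟨v, -⟩ := exists_edge hc y₀
  let gv : Vertex f := ⟨g v.1, fun j => (hg v.1).trans (v.2 j)⟩
  have hv := slide_lift_vertex hc hslide v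
  have hgv : Ft (g v.1) = g v.1 := slide_lift_vertex hc hslide gv
  refine congrFun (hc.eq_of_comp_eq (g₁ := fun y => Ft (g y)) (g₂ := fun y => g (Ft y))
    (Ft.continuous.comp g.continuous) (g.continuous.comp Ft.continuous) (funext fun y => ?_)
    v.1 (by rw [hgv, hv])) y
  change f (Ft (g y)) = f (g (Ft y))
  rw [hl, hg, hg, hl]

/-- The action of a lifted edge slide on homology. -/
theorem homologyIncl_slide_lift [Fintype (Vertex f)] (x : H1 Y) :
    homologyIncl Y (H1map Ft x) = homologyIncl Y x +
      ∑ v, homologyCoeff hc (v, i) x • pathClass (wordLift hc v w).toContinuousMap := by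
  have hedge (e : Vertex f × Fin n) : pathClass (Ft.comp (edge hc e.1 e.2)) =
      pathClass (edge hc e.1 e.2) +
        if e.2 = i then pathClass (wordLift hc e.1 w).toContinuousMap else 0 := by
    obtain ⟨v, j⟩ := e
    by_cases hj : j = i
    · subst hj
      have : Ft.comp (edge hc v j) =
          ((loopLift hc hw v).trans (edgePath hc v j)).toContinuousMap :=
        ContinuousMap.ext fun t => hslide v t
      simp only [if_true, this, isPathCocycle_pathClass.trans, toContinuousMap_loopLift]
      exact add_comm _ _
    · have : Ft.comp (edge hc v j) = edge hc v j := ContinuousMap.ext fun t => hfix v j hj t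
      simp only [if_neg hj, this, add_zero]
  have h := homologyIncl_eq_sum hc x
  rw [homologyIncl_H1map, h, map_sum]
  simp only [map_smul, chainsModBoundariesMap_pathClass, hedge, smul_add, Finset.sum_add_distrib]
  congr 1
  rw [Fintype.sum_prod_type]
  refine Finset.sum_congr rfl fun v _ => ?_
  rw [Finset.sum_eq_single i]
  · simp
  · intro j _ hj
    simp [hj]
  · simp

theorem homologyCoeff_slide_lift_sub [Fintype (Vertex f)] (x : H1 Y) (e : Vertex f × Fin n) :
    homologyCoeff hc e (H1map Ft x - x) =
      ∑ v, homologyCoeff hc (v, i) x * coeff hc e (wordLift hc v w).toContinuousMap := by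
  rw [homologyCoeff, LinearMap.comp_apply, map_sub, homologyIncl_slide_lift hc hfix hslide,
    add_sub_cancel_left, map_sum]
  simp

/-- The difference `H1map Ft x - x` is a combination of lifts of `w`, so it has no `i`-edges and is
not moved again. -/
theorem slide_lift_sub_sq [Finite (Vertex f)] (x : H1 Y) :
    H1map Ft (H1map Ft x - x) = H1map Ft x - x := by
  have := Fintype.ofFinite (Vertex f)
  apply homologyIncl_injective
  rw [homologyIncl_slide_lift hc hfix hslide]
  simp only [homologyCoeff_slide_lift_sub hc hfix hslide, coeff_wordLift_self]
  simp

end SlideLift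

section Deck

/-- The action of a deck transformation on the vertices. -/
def deckMap (g : deckGroup f) (v : Vertex f) : Vertex f :=
  ⟨g.1 v.1, fun j => (g.2 v.1).trans (v.2 j)⟩

theorem deckMap_mul (g h : deckGroup f) (v : Vertex f) :
    deckMap (g * h) v = deckMap g (deckMap h v) := rfl

theorem edgeEnd_deckMap (g : deckGroup f) (v : Vertex f) (j : Fin n) :
    edgeEnd hc (deckMap g v) j = deckMap g (edgeEnd hc v j) := by
  refine Subtype.ext ?_
  have := path_ext hc (γ := edge hc (deckMap g v) j)
    (γ' := (⟨g.1, g.1.continuous⟩ : C(Y, Y)).comp (edge hc v j))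
    (fun t => by
      rw [map_edge hc]
      exact ((g.2 _).trans (map_edge hc v j t)).symm) 0
    (by
      rw [edge_zero, ContinuousMap.comp_apply, edge_zero]
      rfl)
  exact congrArg (fun γ => γ 1) this

include hc in
theorem deckMap_injective [ConnectedSpace Y] (v : Vertex f) :
    Function.Injective fun g : deckGroup f => deckMap g v := by
  intro g h hgh
  have h0 : g.1 v.1 = h.1 v.1 := congrArg Subtype.val hgh
  refine Subtype.ext (Homeomorph.ext fun y => congrFun (hc.eq_of_comp_eq (g₁ := g.1) (g₂ := h.1)
    g.1.continuous h.1.continuous (funext fun y => ?_) v.1 h0) y)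
  exact (g.2 y).trans (h.2 y).symm

section Labelling

variable {G : Type} [Group G] {e : G ≃ Vertex f} {q : {j : Fin n // j ≠ i} → G}
  (he : ∀ g (j : {j : Fin n // j ≠ i}), edgeEnd hc (e g) j = e (g * q j))
include he

/-- The labelling `e` identifies the edges other than the `i`-edges with the Cayley graph of the `q
j`; a word of value `1` therefore closes up at every vertex. -/
theorem wordEnd_labelling (g : G) (w : List {j : Fin n // j ≠ i}) :
    wordEnd hc (e g) w = e (g * wordProd q w) := by
  induction w generalizing g with
  | nil => simp [wordEnd]
  | cons j w ih => rw [wordEnd, he, ih, wordProd_cons, mul_assoc]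

/-- The coefficients of the lifts of a word are given by its Fox derivatives. -/
theorem sum_coeff_wordLift [Fintype G] [Finite (Vertex f)] (w : List {j : Fin n // j ≠ i})
    (c : G → ℚ) (k : {j : Fin n // j ≠ i}) (h : G) :
    ∑ g, c g * coeff hc (e h, k) (wordLift hc (e g) w).toContinuousMap =
      foxProduct q w c k h := by
  induction w generalizing c with
  | nil =>
    refine Finset.sum_eq_zero fun g _ => ?_
    rw [coeff_wordLift_nil, mul_zero]
  | cons j w ih =>
    have hend (g : G) : coeff hc (e h, k)
        (wordLift hc (edgeEnd hc (e g) j) w).toContinuousMap =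
          coeff hc (e h, k) (wordLift hc (e (g * q j)) w).toContinuousMap := by rw [he]
    simp only [coeff_wordLift_cons, hend, mul_add, Finset.sum_add_distrib]
    rw [foxProduct_cons, Pi.add_apply, Pi.add_apply, ← ih (rightTranslate (q j) c)]
    congr 1
    · by_cases hjk : k = j
      · subst hjk
        rw [Finset.sum_eq_single h]
        · simp
        · intro g _ hg
          have hg' : ¬ (e g, k.1) = (e h, k.1) := fun h => hg (e.injective (Prod.mk.inj h).1)
          rw [if_neg hg', mul_zero]
        · simp
      · have hjk' : ¬ j.1 = k.1 := fun h => hjk (Subtype.ext h.symm)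
        simp [Pi.single_eq_of_ne hjk, hjk']
    · rw [← Equiv.sum_comp (Equiv.mulRight (q j)) fun g => rightTranslate (q j) c g *
        coeff hc (e h, k) (wordLift hc (e g) w).toContinuousMap]
      simp

end Labelling

end Deck

end Vertex

/-! ### The slide that moves a given class, and its powers. -/

/-- For every nonzero homology class there is a liftable edge slide that moves it. -/
theorem exists_slide_moving {n : ℕ} (hn : 3 ≤ n) {Y : Type} [TopologicalSpace Y] {f : Y → Wedge n}
    (hf : IsFiniteNormalCover f) {x : H1 Y} (hx : x ≠ 0) :
    ∃ (i : Fin n) (ℓ : Path (base i) (base i)) (F : Wedge n ≃ₕ Wedge n) (Ft : C(Y, Y)),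
      IsEdgeSlide i ℓ F.toFun ∧ IsLiftTrivialOnDeck f F.toFun Ft ∧
      (∀ y, H1map Ft (H1map Ft y - y) = H1map Ft y - y) ∧ H1map Ft x - x ≠ 0 := by
  have hc := hf.isCoveringMap
  have := hf.connected
  let j₀ : Fin n := ⟨0, by omega⟩
  have hfin : Finite (Vertex f) := by
    have : Finite (f ⁻¹' {base j₀}) := hf.finite_fiber _
    exact Finite.of_injective (fun v : Vertex f => (⟨v.1, v.2 j₀⟩ : f ⁻¹' {base j₀}))
      fun v w h => Subtype.ext (congrArg (fun z : f ⁻¹' {base j₀} => z.1) h)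
  have := Fintype.ofFinite (Vertex f)
  obtain ⟨y₀, hy₀⟩ := hf.surjective (base j₀)
  let v₀ : Vertex f := ⟨y₀, fun j => hy₀.trans (base_eq_base j₀ j)⟩
  -- The deck group acts freely by connectedness and transitively by normality, so `v₀` labels the
  -- vertices by its elements.
  let e : deckGroup f ≃ Vertex f := Equiv.ofBijective (fun g => Vertex.deckMap g v₀)
    ⟨Vertex.deckMap_injective hc v₀, fun v => by
      obtain ⟨g, hg, hgv⟩ := hf.transitive y₀ v.1 (hy₀.trans (v.2 j₀).symm)
      exact ⟨⟨g, hg⟩, Subtype.ext hgv⟩⟩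
  have := Fintype.ofEquiv _ e.symm
  obtain ⟨⟨u, i⟩, hui⟩ := Vertex.exists_homologyCoeff_ne_zero hc hx
  let q (j : {j : Fin n // j ≠ i}) : deckGroup f := e.symm (Vertex.edgeEnd hc v₀ j)
  have he (g : deckGroup f) (j : {j : Fin n // j ≠ i}) :
      Vertex.edgeEnd hc (e g) j = e (g * q j) := by
    have hq : Vertex.deckMap (q j) v₀ = Vertex.edgeEnd hc v₀ j :=
      e.apply_symm_apply (Vertex.edgeEnd hc v₀ j)
    change Vertex.edgeEnd hc (Vertex.deckMap g v₀) j = Vertex.deckMap (g * q j) v₀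
    rw [Vertex.edgeEnd_deckMap, Vertex.deckMap_mul, hq]
  -- This is where `n ≥ 3` enters: two petals must remain besides `a_i`.
  have hcard : 2 ≤ Fintype.card {j : Fin n // j ≠ i} := by
    simp [Fintype.card_subtype_compl]
    omega
  have hcne : (fun g => Vertex.homologyCoeff hc (e g, i) x) ≠ 0 := fun h0 =>
    hui (by simpa using congrFun h0 (e.symm u))
  obtain ⟨w, hw, hwne⟩ := exists_relation_foxProduct_ne_zero hcard q hcne
  have hclosed (v : Vertex f) : Vertex.wordEnd hc v w = v := by
    obtain ⟨g, rfl⟩ := e.surjective v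
    rw [Vertex.wordEnd_labelling hc he, hw, mul_one]
  obtain ⟨⟨k, hk⟩⟩ : Nonempty {j : Fin n // j ≠ i} := Fintype.card_pos_iff.mp (by omega)
  obtain ⟨F, hF⟩ := exists_homotopyEquiv (wordLoop_avoids hk w)
  obtain ⟨Ft, hfix, hslide⟩ := Vertex.exists_slide_lift hc hclosed
  refine ⟨i, wordLoop i w, F, Ft, hF, Vertex.slide_lift_isLift hc hfix hslide hF,
    Vertex.slide_lift_sub_sq hc hfix hslide, fun h0 => hwne ?_⟩
  ext k h
  rw [← Vertex.sum_coeff_wordLift hc he]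
  have := Vertex.homologyCoeff_slide_lift_sub hc hfix hslide x (e h, k.1)
  rw [h0, map_zero, ← Equiv.sum_comp e] at this
  exact this.symm

theorem H1map_mem_gammaOrbit {X Y : Type} [TopologicalSpace X] [TopologicalSpace Y]
    {f : Y → X} {F : X ≃ₕ X} {Ft : C(Y, Y)} (h : IsLiftTrivialOnDeck f F.toFun Ft) {v x : H1 Y}
    (hx : x ∈ gammaOrbit f v) : H1map Ft x ∈ gammaOrbit f v := by
  obtain ⟨F', Ft', h', rfl⟩ := hx
  refine ⟨F'.trans F, Ft.comp Ft', ⟨fun y => ?_, fun g hg y => ?_⟩, (H1map_comp Ft Ft' v).symm⟩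
  · exact (h.lifts _).trans (congrArg F.toFun (h'.lifts y))
  · exact (congrArg Ft (h'.commutes g hg y)).trans (h.commutes g hg _)

theorem self_mem_gammaOrbit {X Y : Type} [TopologicalSpace X] [TopologicalSpace Y]
    (f : Y → X) (v : H1 Y) : v ∈ gammaOrbit f v :=
  ⟨ContinuousMap.HomotopyEquiv.refl X, ContinuousMap.id Y, ⟨fun _ => rfl, fun _ _ _ => rfl⟩, (H1map_id v).symm⟩

/-- A linear map `T` with `(T - 1)² = 0` is an automorphism, and its powers grow linearly. -/
theorem exists_equiv_of_unipotent {V : Type*} [AddCommGroup V] [Module ℚ V] (T : V →ₗ[ℚ] V)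
    (hT : ∀ y, T (T y - y) = T y - y) :
    ∃ A : V ≃ₗ[ℚ] V, (∀ y, A y = T y) ∧ ∀ (d : ℤ) y, (A ^ d) y = y + d • (T y - y) := by
  have hTT (y : V) : T (T y) = T y - y + T y := by
    rw [← sub_eq_iff_eq_add, ← map_sub, hT]
  -- With `N = T - 1` and `N² = 0`, the inverse of `1 + N` is `1 - N`.
  let A : V ≃ₗ[ℚ] V := LinearEquiv.ofLinearMap T (LinearMap.id - (T - LinearMap.id))
    (by
      ext y
      simp only [LinearMap.comp_apply, LinearMap.sub_apply, LinearMap.id_apply, map_sub, hTT]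
      abel)
    (by
      ext y
      simp only [LinearMap.comp_apply, LinearMap.sub_apply, LinearMap.id_apply, hTT]
      abel)
  have hA (y : V) : A y = T y := rfl
  have hA' (y : V) : A⁻¹ y = y - (T y - y) := rfl
  have hN (d : ℤ) (y : V) : T (y + d • (T y - y)) - (y + d • (T y - y)) = T y - y := by
    rw [map_add, map_zsmul, hT]
    abel
  refine ⟨A, hA, fun d => ?_⟩
  induction d using Int.induction_on with
  | zero => simp
  | succ d ih =>
    intro y
    rw [add_comm, zpow_add, zpow_one, LinearEquiv.mul_apply, ih, hA,
      sub_eq_iff_eq_add.mp (hN d y), add_smul, one_smul]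
    abel
  | pred d ih =>
    intro y
    rw [sub_eq_add_neg, add_comm, zpow_add, zpow_neg_one, LinearEquiv.mul_apply, ih, hA', hN,
      add_smul, neg_one_zsmul]
    abel

theorem theorem1p1 (n : ℕ) (hn : 3 ≤ n) (Y : Type) [TopologicalSpace Y]
    (f : Y → Wedge n) (hf : IsFiniteNormalCover f) (v : H1 Y) (hv : v ≠ 0) :
    (gammaOrbit f v).Infinite ∧
    ∃ (i : Fin n) (ℓ : Path (Wedge.base i) (Wedge.base i)) (F : Wedge n ≃ₕ Wedge n) (Ft : C(Y, Y)),
      Wedge.IsEdgeSlide i ℓ F.toFun ∧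
      IsLiftTrivialOnDeck f F.toFun Ft ∧
      ∃ A : H1 Y ≃ₗ[ℚ] H1 Y, (∀ w, A w = H1map Ft w) ∧
        Function.Injective (fun d : ℤ => (A ^ d) v) := by
  obtain ⟨i, ℓ, F, Ft, hF, hlift, hsq, hne⟩ := exists_slide_moving hn hf hv
  obtain ⟨A, hA, hpow⟩ := exists_equiv_of_unipotent (H1map Ft) hsq
  have hinj : Function.Injective (fun d : ℤ => (A ^ d) v) := by
    intro d d' h
    simp only [hpow, add_right_inj] at h
    simp only [← Int.cast_smul_eq_zsmul ℚ] at h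
    exact Int.cast_injective (smul_left_injective ℚ hne h)
  refine ⟨?_, i, ℓ, F, Ft, hF, hlift, A, hA, hinj⟩
  -- Nonnegative powers already give infinitely many points, and they stay in the orbit by composing
  -- with `F` and `Ft`; no lift of the inverse equivalence is needed.
  refine Set.infinite_of_injective_forall_mem (hinj.comp Nat.cast_injective) fun d => ?_
  change (A ^ (d : ℤ)) v ∈ gammaOrbit f v
  induction d with
  | zero => simpa using self_mem_gammaOrbit f v
  | succ d ih =>
    rw [Nat.cast_succ, add_comm, zpow_add, zpow_one, LinearEquiv.mul_apply, hA]
    exact H1map_mem_gammaOrbit hlift ih
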